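/- **Setting.** Let $r:\mathbb R\to(0,\infty)$ be smooth with $r(\theta+\pi)=r(\theta)$, such that the closed curve $\partial\mathcal U=\{r(\theta)(\cos\theta,\sin\theta)\}$ (the *indicatrix*) has strictly positive Euclidean curvature. The Minkowski plane $\mathcal M^2$ is $\mathbb R^2$ with the norm $l(x)=|x|/r(\theta)$ for $x=|x|(\cos\theta,\sin\theta)$. Put $h=1/r$, $\tau(\theta)=(\cos\theta,\sin\theta)$, $n(\theta)=(-\sin\theta,\cos\theta)$ and $N(\theta)=-h_\theta\,\tau+h\,n$. The *isoperimetrix* $\tilde{\mathcal I}$ is the closed curve $\theta\mapsto N(\theta)$, $\theta\in[0,2\pi)$. For a regular smooth immersed closed curve $\gamma:\mathbb S^1\to\mathcal M^2$ with Euclidean arc length $s$, tangent angle $\theta$ and signed Euclidean curvature $k$, let $d\sigma=l(\gamma_u)\,du$ be the Minkowski arc length element, $\kappa=k\,(h+h_{\theta\theta})$ the Minkowski curvature (with $h$ evaluated at the tangent angle), $\kappa_{\sigma^m}$ its $m$-th derivative with respect to $\sigma$, and $$\mathscr L(\gamma)=\int_\gamma d\sigma,\qquad \mathscr A(\gamma)=-\tfrac12\int_\gamma\langle\gamma,n\rangle\,ds,\qquad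 \bar\kappa=\frac1{\mathscr L}\int_\gamma\kappa\,d\sigma,$$ $$K_{osc}(\gamma)=\mathscr L(\gamma)\int_\gamma(\kappa-\bar\kappa)^2\,d\sigma,\qquad \mathscr I(\gamma)=\frac{\mathscr L(\gamma)^2}{4\,\mathscr A(\gamma)\,\mathscr A(\tilde{\mathcal I})}.$$ For an integer $p\ge1$ and $T\in(0,\infty]$, a *$2(p+1)$-anisotropic polyharmonic curve flow* is a smooth family $\Gamma:\mathbb S^1\times[0,T)\to\mathcal M^2$ of regular immersed closed curves with $$\partial_t\Gamma=(-1)^p\,\kappa_{\sigma^{2p}}\,N .$$ **Proposition (upper bound on the waiting time for convexity).** For every such $\mathcal M^2$ and every integer $p\ge1$ there is a constant $\varepsilon_0>0$, depending only on $p$ and $\partial\mathcal U$, with the following property. Let $T\in(0,\infty]$, let $\Gamma:\mathbb S^1\times[0,T)\to\mathcal M^2$ be a $2(p+1)$-anisotropic polyharmonic curve flow, and suppose that its initial curve $\Gamma_0=\Gamma(\cdot,0)$ satisfies $$\mathscr A(\Gamma_0)>0,\qquad K_{osc}(\Gamma_0)<\varepsilon_0,\qquad \mathscr I(\Gamma_0)<\exp\!\left(\frac{\varepsilon_0}{8\,\mathscr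 A(\tilde{\mathcal I})^2}\right).$$ Then the set of times in $[0,T)$ at which $\kappa(\cdot,t)$ is $\le0$ at some point of the curve has finite Lebesgue measure, and $$\mathcal L\{t\in[0,T):\ \kappa(u,t)\le0\text{ for some }u\in\mathbb S^1\}\ \le\ \frac{8\,\mathscr A(\tilde{\mathcal I})^{p-1}\,\mathscr A(\Gamma_0)^{p+1}}{(p+1)\,\pi^{2p}}\left(\mathscr I(\Gamma_0)^{p+1}-1\right).$$ In particular, this holds with $[0,\infty)$ in place of $[0,T)$ when the flow exists for all time. -/

import Mathlib

open Real MeasureTheory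
open scoped ContDiff

noncomputable section

namespace AnisotropicFlow

/-! The Euclidean plane `ℝ²` is `ℂ` (its norm and its real inner product are the Euclidean ones,
and multiplication by `Complex.I` is the counterclockwise rotation by a right angle).  Maps on the
circle are `2π`-periodic maps on `ℝ`, with parameter `u`. -/

/-! ### Euclidean geometry of plane curves -/

/-- The Euclidean unit tangent `τ = γ_u / |γ_u|`. -/
def unitTangent (γ : ℝ → ℂ) (u : ℝ) : ℂ := deriv γ u / (‖deriv γ u‖ : ℂ)

/-- The Euclidean unit normal `n`: the unit tangent turned counterclockwise by a right angle. -/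
def unitNormal (γ : ℝ → ℂ) (u : ℝ) : ℂ := Complex.I * unitTangent γ u

/-- The angle that the tangent makes with the `x`-axis, as a representative in `(-π, π]`. -/
def tangentAngle (γ : ℝ → ℂ) (u : ℝ) : ℝ := Complex.arg (deriv γ u)

/-- The signed Euclidean curvature `k = det (γ_u, γ_uu) / |γ_u|³`. -/
def euclideanCurvature (γ : ℝ → ℂ) (u : ℝ) : ℝ :=
  ((deriv γ u).re * (deriv (deriv γ) u).im - (deriv γ u).im * (deriv (deriv γ) u).re) /
    ‖deriv γ u‖ ^ 3

/-- The (signed) enclosed area `𝒜(γ) = -(1/2) ∫ ⟨γ, n⟩ ds` of a closed curve. -/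
def enclosedArea (γ : ℝ → ℂ) : ℝ :=
  -(1 / 2) * ∫ u in (0 : ℝ)..(2 * π), inner ℝ (γ u) (unitNormal γ u) * ‖deriv γ u‖

/-- A regular smooth immersed closed curve `γ : 𝕊¹ → ℝ²`. -/
structure IsClosedImmersion (γ : ℝ → ℂ) : Prop where
  smooth : ContDiff ℝ ∞ γ
  periodic : Function.Periodic γ (2 * π)
  immersed : ∀ u, deriv γ u ≠ 0

/-! ### The Minkowski plane -/

/-- A Minkowski plane, given by its indicatrix `∂𝒰 = {r(θ)(cos θ, sin θ)}`: a smooth curve, centrally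
symmetric about the origin, with strictly positive Euclidean curvature (so that the domain `𝒰` it
bounds is convex). -/
structure MinkowskiPlane where
  /-- The radial function of the indicatrix. -/
  r : ℝ → ℝ
  smooth : ContDiff ℝ ∞ r
  pos : ∀ θ, 0 < r θ
  symm : ∀ θ, r (θ + π) = r θ
  curvature_pos : ∀ θ, 0 < euclideanCurvature
    (fun φ => (r φ : ℂ) * ((Real.cos φ : ℂ) + (Real.sin φ : ℂ) * Complex.I)) θ

namespace MinkowskiPlane

variable (M : MinkowskiPlane)

/-- The polar radial support function `h = 1 / r`. -/
def h (θ : ℝ) : ℝ := 1 / M.r θ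

/-- The Minkowski norm `l(x) = |x| / r(θ)`, where `x = |x|(cos θ, sin θ)`. -/
def l (x : ℂ) : ℝ := ‖x‖ / M.r (Complex.arg x)

/-- The Minkowski normal at tangent angle `θ`:
`N(θ) = -h_θ (cos θ, sin θ) + h (-sin θ, cos θ)`. -/
def N (θ : ℝ) : ℂ :=
  -((deriv M.h θ : ℝ) : ℂ) * ((Real.cos θ : ℂ) + (Real.sin θ : ℂ) * Complex.I) +
    ((M.h θ : ℝ) : ℂ) * (-(Real.sin θ : ℂ) + (Real.cos θ : ℂ) * Complex.I)

/-- The enclosed area `𝒜(Ĩ)` of the isoperimetrix, the closed curve `θ ↦ N(θ)`. -/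
def isoperimetrixArea : ℝ := enclosedArea M.N

/-- The Minkowski length `ℒ(γ) = ∫ dσ`, where `dσ = l(γ_u) du`. -/
def length (γ : ℝ → ℂ) : ℝ := ∫ u in (0 : ℝ)..(2 * π), M.l (deriv γ u)

/-- The integral `∫ f dσ` of a function along `γ`. -/
def integral (γ : ℝ → ℂ) (f : ℝ → ℝ) : ℝ := ∫ u in (0 : ℝ)..(2 * π), f u * M.l (deriv γ u)

/-- The derivative `f_σ = f_u / l(γ_u)` with respect to Minkowski arc length. -/
def dσ (γ : ℝ → ℂ) (f : ℝ → ℝ) : ℝ → ℝ := fun u => deriv f u / M.l (deriv γ u)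

/-- The Minkowski curvature `κ = k (h + h_θθ)`, at the tangent angle `θ` of the curve. -/
def curvature (γ : ℝ → ℂ) (u : ℝ) : ℝ :=
  euclideanCurvature γ u *
    (M.h (tangentAngle γ u) + deriv (deriv M.h) (tangentAngle γ u))

/-- The `m`-th derivative `κ_{σ^m}` of the curvature with respect to Minkowski arc length. -/
def curvatureDeriv (γ : ℝ → ℂ) (m : ℕ) : ℝ → ℝ := (M.dσ γ)^[m] (M.curvature γ)

/-- The average curvature `κ̄ = (1/ℒ) ∫ κ dσ`. -/
def meanCurvature (γ : ℝ → ℂ) : ℝ := 1 / M.length γ * M.integral γ (M.curvature γ)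

/-- The normalised oscillation of curvature `K_osc(γ) = ℒ ∫ (κ - κ̄)² dσ`. -/
def kosc (γ : ℝ → ℂ) : ℝ :=
  M.length γ * M.integral γ (fun u => (M.curvature γ u - M.meanCurvature γ) ^ 2)

/-- The anisotropic isoperimetric ratio `ℐ(γ) = ℒ² / (4 𝒜(γ) 𝒜(Ĩ))`. -/
def isoperimetricRatio (γ : ℝ → ℂ) : ℝ :=
  M.length γ ^ 2 / (4 * enclosedArea γ * M.isoperimetrixArea)

end MinkowskiPlane

/-- The time interval `[0, T)`, where `T` may be `∞`. -/
def timeInterval (T : EReal) : Set ℝ := {t | 0 ≤ t ∧ (t : EReal) < T}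

/-- `Γ : 𝕊¹ × [0, T) → ℳ²` is a `2(p+1)`-anisotropic polyharmonic curve flow: a family of closed
immersed curves `Γ t`, smooth on `[0, T) × 𝕊¹`, with `∂_t Γ = (-1)^p κ_{σ^{2p}} N` (the time
derivative is one-sided at `t = 0`). -/
structure IsPolyharmonicFlow (M : MinkowskiPlane) (p : ℕ) (T : EReal) (Γ : ℝ → ℝ → ℂ) : Prop where
  pos_time : 0 < T
  smooth : ContDiffOn ℝ ∞ (Function.uncurry Γ) (timeInterval T ×ˢ Set.univ)
  closed_immersion : ∀ t ∈ timeInterval T, IsClosedImmersion (Γ t)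
  evolution : ∀ t ∈ timeInterval T, ∀ u : ℝ,
    HasDerivWithinAt (fun s => Γ s u)
      ((((-1) ^ p * M.curvatureDeriv (Γ t) (2 * p) u : ℝ) : ℂ) * M.N (tangentAngle (Γ t) u))
      (timeInterval T) t

end AnisotropicFlow

end

noncomputable section

namespace AnisotropicFlow

/-! Along the flow the area is constant and `L' = -∫ κ_{σ^p}² dσ`, so `L` decreases while the
isoperimetric inequality keeps `L² ≥ 4𝒜(Γ₀)𝒜(Ĩ)`. A time at which `κ ≤ 0` somewhere forces a
definite rate of decrease of `L^{2p+2}`; hence such times fill only a set of finite measure.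

The rate comes from topology. Since `κ dσ = h(h + h_θθ) dθ`, the total curvature is `2𝒜(Ĩ)` times
the turning number, and it is constant in time. Initially `K_osc < m⁴`, with `m` a positive lower
bound of `h`, and positive area make `κ̄` positive (`length_sub_le`, `meanCurvature_pos`), so the
turning number is at least one and `κ̄ ≥ 2𝒜(Ĩ)/L` at every time; the oscillation is needed only at
time zero. If `κ ≤ 0` at a point, `κ` must climb to `κ̄` and return within one period, so `2κ̄ ≤ ∫
|κ_σ| dσ`. Cauchy–Schwarz (`four_mul_sq_meanCurvature_le`) and `p - 1` applications of Wirtinger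
(`integral_sq_curvatureDeriv_one_le`) give `16 𝒜(Ĩ)² (2π)^{2p-2} ≤ L^{2p+1} ∫ κ_{σ^p}² dσ`, and the
right side is `-(L^{2p+2})'/(2p+2)`. Chebyshev's inequality (`volume_le_of_deriv_le`) then bounds
the measure of the bad times, with constant `π²/16` times the stated one.

The isoperimetric inequality is proved for immersed curves by Schmidt's method: each of the two arcs
between the extreme vertical lines is compared with half of a rescaled isoperimetrix. -/

/-! ### Unit vectors, periodic functions and the area form. -/

/-- The unit vector at angle `θ`. -/
def dir (θ : ℝ) : ℂ := Complex.exp (θ * Complex.I)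

lemma dir_eq (θ : ℝ) :
    dir θ = (Real.cos θ : ℂ) + (Real.sin θ : ℂ) * Complex.I := by
  simp [dir, Complex.exp_mul_I]

@[simp] lemma dir_re (θ : ℝ) : (dir θ).re = Real.cos θ := by
  simp [dir, Complex.exp_ofReal_mul_I_re]

@[simp] lemma dir_im (θ : ℝ) : (dir θ).im = Real.sin θ := by
  simp [dir, Complex.exp_ofReal_mul_I_im]

@[simp] lemma norm_dir (θ : ℝ) : ‖dir θ‖ = 1 := Complex.norm_exp_ofReal_mul_I θ

lemma dir_ne_zero (θ : ℝ) : dir θ ≠ 0 := Complex.exp_ne_zero _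

lemma dir_add (θ φ : ℝ) : dir (θ + φ) = dir θ * dir φ := by
  simp [dir, add_mul, Complex.exp_add]

lemma conj_dir_mul_dir (θ : ℝ) : (starRingEnd ℂ) (dir θ) * dir θ = 1 := by
  rw [mul_comm, Complex.mul_conj, Complex.normSq_eq_norm_sq]; simp

lemma hasDerivAt_dir (θ : ℝ) : HasDerivAt dir (Complex.I * dir θ) θ := by
  have h1 : HasDerivAt (fun t : ℝ => (t : ℂ) * Complex.I) (1 * Complex.I) θ :=
    (Complex.ofRealCLM.hasDerivAt (x := θ)).mul_const _
  have := h1.cexp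
  exact this.congr_deriv (by rw [one_mul, dir, mul_comm])

lemma contDiff_dir : ContDiff ℝ ∞ dir := by
  unfold dir
  exact (Complex.ofRealCLM.contDiff.mul contDiff_const).cexp

lemma dir_periodic : Function.Periodic dir (2 * π) := by
  intro θ
  rw [dir_eq, dir_eq, Real.cos_add_two_pi, Real.sin_add_two_pi]

lemma exists_int_of_dir_eq {θ φ : ℝ} (h : dir θ = dir φ) :
    ∃ n : ℤ, θ = φ + n * (2 * π) := by
  obtain ⟨n, hn⟩ := Complex.exp_eq_exp_iff_exists_int.1 h
  refine ⟨n, ?_⟩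
  have := congrArg Complex.im hn
  simpa using this

lemma _root_.Function.Periodic.eq_of_dir_eq {α : Type*} {f : ℝ → α}
    (hf : Function.Periodic f (2 * π)) {θ φ : ℝ} (h : dir θ = dir φ) : f θ = f φ := by
  obtain ⟨n, rfl⟩ := exists_int_of_dir_eq h
  exact hf.int_mul n φ

lemma _root_.Function.Periodic.deriv {E : Type*} [NormedAddCommGroup E] [NormedSpace ℝ E]
    {f : ℝ → E} {c : ℝ} (hf : Function.Periodic f c) : Function.Periodic (deriv f) c := by
  intro x
  rw [← deriv_comp_add_const]
  congr 1
  exact funext hf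

lemma _root_.ContDiff.deriv_infty {E : Type*} [NormedAddCommGroup E] [NormedSpace ℝ E]
    {f : ℝ → E} (hf : ContDiff ℝ ∞ f) : ContDiff ℝ ∞ (deriv f) :=
  (contDiff_infty_iff_deriv.1 hf).2

lemma _root_.ContDiff.hasDerivAt_infty {E : Type*} [NormedAddCommGroup E] [NormedSpace ℝ E]
    {f : ℝ → E} (hf : ContDiff ℝ ∞ f) (x : ℝ) : HasDerivAt f (deriv f x) x :=
  ((contDiff_infty_iff_deriv.1 hf).1 x).hasDerivAt

/-- The form `x dy - y dx` involves no division by the speed, so it can be differentiated in time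
directly. -/
lemma enclosedArea_eq (γ : ℝ → ℂ) :
    enclosedArea γ =
      1 / 2 * ∫ u in (0 : ℝ)..(2 * π), ((starRingEnd ℂ) (γ u) * deriv γ u).im := by
  unfold enclosedArea
  rw [neg_mul, ← mul_neg, ← intervalIntegral.integral_neg]
  congr 1
  apply intervalIntegral.integral_congr
  intro u _
  simp only [unitNormal, unitTangent]
  by_cases h : deriv γ u = 0
  · simp [h]
  have h' : ‖deriv γ u‖ ≠ 0 := by simpa using h
  have h2 : Complex.I * (deriv γ u / (‖deriv γ u‖ : ℂ)) =
      ((‖deriv γ u‖⁻¹ : ℝ) : ℂ) * (Complex.I * deriv γ u) := by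
    push_cast; ring
  rw [h2, Complex.inner, mul_assoc, Complex.re_ofReal_mul]
  field_simp
  simp

/-! ### The support function, the isoperimetrix and the norm. -/

namespace MinkowskiPlane

variable (M : MinkowskiPlane)

lemma contDiff_h : ContDiff ℝ ∞ M.h := by
  unfold h
  exact contDiff_const.div M.smooth (fun θ => (M.pos θ).ne')

lemma h_pos (θ : ℝ) : 0 < M.h θ := one_div_pos.2 (M.pos θ)

lemma h_add_pi (θ : ℝ) : M.h (θ + π) = M.h θ := by simp [h, M.symm]

lemma h_periodic : Function.Periodic M.h (2 * π) := by
  intro θ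
  rw [two_mul, ← add_assoc, h_add_pi, h_add_pi]

/-- The radius of curvature `h + h_θθ` of the isoperimetrix. -/
def q (θ : ℝ) : ℝ := M.h θ + deriv (deriv M.h) θ

lemma contDiff_q : ContDiff ℝ ∞ M.q :=
  M.contDiff_h.add M.contDiff_h.deriv_infty.deriv_infty

lemma q_periodic : Function.Periodic M.q (2 * π) :=
  fun θ => congrArg₂ (· + ·) (M.h_periodic θ) (M.h_periodic.deriv.deriv θ)

/-- The curvature of the indicatrix and `h + h_θθ` are both positive multiples of `r² + 2r_θ² - r
r_θθ`. This is where convexity of the indicatrix enters. -/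
lemma q_pos (θ : ℝ) : 0 < M.q θ := by
  have hr := fun θ => M.smooth.hasDerivAt_infty θ
  have hr' := fun θ => M.smooth.deriv_infty.hasDerivAt_infty θ
  have e1 : (fun φ => (M.r φ : ℂ) * ((Real.cos φ : ℂ) + (Real.sin φ : ℂ) * Complex.I)) =
      fun φ => (M.r φ : ℂ) * dir φ := by
    funext φ; rw [dir_eq]
  have d1 : deriv (fun φ => (M.r φ : ℂ) * dir φ) =
      fun φ => ((deriv M.r φ : ℝ) + (M.r φ : ℝ) * Complex.I) * dir φ := by
    funext φ
    refine ((hr φ).ofReal_comp.mul (hasDerivAt_dir φ)).deriv.trans ?_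
    ring
  have d2 : deriv (fun φ => ((deriv M.r φ : ℝ) + (M.r φ : ℝ) * Complex.I) * dir φ) θ =
      ((deriv (deriv M.r) θ - M.r θ : ℝ) + (2 * deriv M.r θ : ℝ) * Complex.I) * dir θ := by
    refine (((hr' θ).ofReal_comp.add ((hr θ).ofReal_comp.mul_const Complex.I)).mul
      (hasDerivAt_dir θ)).deriv.trans ?_
    simp only [Pi.add_apply]
    push_cast
    linear_combination (M.r θ : ℂ) * dir θ * Complex.I_mul_I
  have hk := M.curvature_pos θ
  rw [e1, euclideanCurvature, d1, d2] at hk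
  have hd : 0 < ‖((deriv M.r θ : ℝ) + (M.r θ : ℝ) * Complex.I) * dir θ‖ ^ 3 := by
    have : ((deriv M.r θ : ℝ) + (M.r θ : ℝ) * Complex.I : ℂ) ≠ 0 := by
      intro h0
      have := congrArg Complex.im h0
      simp at this
      exact (M.pos θ).ne' this
    have := mul_ne_zero this (dir_ne_zero θ)
    positivity
  have hn := (div_pos_iff_of_pos_right hd).1 hk
  have hn2 : 0 < M.r θ ^ 2 + 2 * deriv M.r θ ^ 2 - M.r θ * deriv (deriv M.r) θ := by
    simp at hn
    nlinarith [Real.sin_sq_add_cos_sq θ]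
  have h1 : deriv M.h = fun θ => - deriv M.r θ / M.r θ ^ 2 := by
    funext φ
    have := (hr φ).fun_inv (M.pos φ).ne'
    rw [← this.deriv]
    congr 1
    funext x
    simp [h]
  have h2 : deriv (deriv M.h) θ = 
      (-deriv (deriv M.r) θ * M.r θ ^ 2 + deriv M.r θ * (2 * M.r θ * deriv M.r θ))
        / (M.r θ ^ 2) ^ 2 := by
    rw [h1]
    refine ((hr' θ).neg.div ((hr θ).pow 2) (pow_ne_zero _ (M.pos θ).ne')).deriv.trans ?_
    simp
  have hp := M.pos θ
  have : M.q θ = (M.r θ ^ 2 + 2 * deriv M.r θ ^ 2 - M.r θ * deriv (deriv M.r) θ) / M.r θ ^ 3 := by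
    rw [q, h2, h]
    field_simp
    ring
  rw [this]
  positivity

lemma exists_pos_le_h : ∃ m : ℝ, 0 < m ∧ ∀ θ, m ≤ M.h θ := by
  obtain ⟨θ₀, -, h₀⟩ := (isCompact_Icc (a := (0 : ℝ)) (b := 2 * π)).exists_isMinOn
    ⟨0, by simp [Real.pi_pos.le]⟩ M.contDiff_h.continuous.continuousOn
  refine ⟨M.h θ₀, M.h_pos θ₀, fun θ => ?_⟩
  obtain ⟨φ, hφ, e⟩ := M.h_periodic.exists_mem_Ico₀ (by positivity) θ
  rw [e]
  exact h₀ ⟨hφ.1, hφ.2.le⟩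

lemma N_eq (θ : ℝ) : M.N θ = (-(deriv M.h θ : ℝ) + (M.h θ : ℝ) * Complex.I) * dir θ := by
  rw [N, dir_eq]
  linear_combination -(M.h θ : ℂ) * (Real.sin θ : ℂ) * Complex.I_mul_I

/-- The normal components `±h_θ` cancel, so the isoperimetrix at `N(θ)` is tangent to direction `θ`.
-/
lemma hasDerivAt_N (θ : ℝ) : HasDerivAt M.N (-(M.q θ : ℂ) * dir θ) θ := by
  have e : M.N = fun θ => (-(deriv M.h θ : ℝ) + (M.h θ : ℝ) * Complex.I) * dir θ :=
    funext M.N_eq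
  rw [e]
  refine (((M.contDiff_h.deriv_infty.hasDerivAt_infty θ).ofReal_comp.neg.add
    ((M.contDiff_h.hasDerivAt_infty θ).ofReal_comp.mul_const Complex.I)).mul
      (hasDerivAt_dir θ)).congr_deriv ?_
  simp only [Pi.add_apply, Pi.neg_apply, q]
  push_cast
  linear_combination (M.h θ : ℂ) * dir θ * Complex.I_mul_I

lemma contDiff_N : ContDiff ℝ ∞ M.N := by
  have e : M.N = fun θ => (-(deriv M.h θ : ℝ) + (M.h θ : ℝ) * Complex.I) * dir θ :=
    funext M.N_eq
  rw [e]
  have h1 := Complex.ofRealCLM.contDiff.comp M.contDiff_h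
  have h2 := Complex.ofRealCLM.contDiff.comp M.contDiff_h.deriv_infty
  exact (h2.neg.add (h1.mul contDiff_const)).mul contDiff_dir

lemma N_periodic : Function.Periodic M.N (2 * π) := by
  intro θ
  rw [N_eq, N_eq, M.h_periodic, M.h_periodic.deriv, dir_periodic]

lemma im_conj_N_mul_dir (θ : ℝ) : ((starRingEnd ℂ) (M.N θ) * dir θ).im = - M.h θ := by
  rw [N_eq, map_mul, mul_assoc, conj_dir_mul_dir]
  simp

lemma isoperimetrixArea_eq :
    M.isoperimetrixArea = 1 / 2 * ∫ θ in (0 : ℝ)..(2 * π), M.h θ * M.q θ := by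
  rw [isoperimetrixArea, enclosedArea_eq]
  congr 1
  apply intervalIntegral.integral_congr
  intro θ _
  have := M.im_conj_N_mul_dir θ
  simp only [(M.hasDerivAt_N θ).deriv]
  rw [show (starRingEnd ℂ) (M.N θ) * (-(M.q θ : ℂ) * dir θ) =
    ((-M.q θ : ℝ) : ℂ) * ((starRingEnd ℂ) (M.N θ) * dir θ) by push_cast; ring,
    Complex.im_ofReal_mul, this]
  ring

lemma isoperimetrixArea_pos : 0 < M.isoperimetrixArea := by
  rw [isoperimetrixArea_eq]
  have : 0 < ∫ θ in (0 : ℝ)..(2 * π), M.h θ * M.q θ :=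
    intervalIntegral.intervalIntegral_pos_of_pos
      ((M.contDiff_h.continuous.mul M.contDiff_q.continuous).intervalIntegrable _ _)
      (fun θ => mul_pos (M.h_pos θ) (M.q_pos θ)) (by positivity)
  positivity

lemma l_mul_dir {ρ : ℝ} (hρ : 0 < ρ) (θ : ℝ) : M.l (ρ * dir θ) = ρ * M.h θ := by
  have h1 : ‖(ρ : ℂ) * dir θ‖ = ρ := by simp [abs_of_pos hρ]
  have h2 : dir (Complex.arg (ρ * dir θ)) = dir θ := by
    have := Complex.norm_mul_exp_arg_mul_I (ρ * dir θ)
    rw [h1] at this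
    exact mul_left_cancel₀ (by exact_mod_cast hρ.ne') this
  rw [l, h1, ← M.h_periodic.eq_of_dir_eq h2, h]
  ring

lemma l_pos {z : ℂ} (hz : z ≠ 0) : 0 < M.l z :=
  div_pos (norm_pos_iff.2 hz) (M.pos _)

/-- Dividing by a base point moves the logarithm near `1`, away from its branch cut; periodicity of
`h` absorbs the jump of `arg`. Smoothness of `l` then also holds on the negative real axis. -/
lemma l_eq_exp_log {ρ θ : ℝ} (hρ : 0 < ρ) {z : ℂ} (hz : z ≠ 0) :
    M.l z = ρ * Real.exp (Complex.log (z / (ρ * dir θ))).re *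
      M.h (θ + (Complex.log (z / (ρ * dir θ))).im) := by
  rw [← l_mul_dir _ (by positivity)]
  congr 1
  have h0 : (ρ : ℂ) * dir θ ≠ 0 := mul_ne_zero (by exact_mod_cast hρ.ne') (dir_ne_zero θ)
  set ζ := Complex.log (z / (ρ * dir θ)) with hζ
  have : Complex.exp ζ = z / (ρ * dir θ) := Complex.exp_log (div_ne_zero hz h0)
  have h3 : (ζ.re : ℂ) + ζ.im * Complex.I = ζ := Complex.re_add_im ζ
  rw [dir_add]
  push_cast
  rw [show (ρ : ℂ) * Complex.exp ζ.re * (dir θ * dir ζ.im) =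
    (Complex.exp ζ.re * dir ζ.im) * (ρ * dir θ) by ring, dir, ← Complex.exp_add, h3, this,
    div_mul_cancel₀ _ h0]

lemma eventually_l_eq {ρ θ : ℝ} (hρ : 0 < ρ) :
    M.l =ᶠ[nhds (ρ * dir θ)] fun z => ρ * Real.exp (Complex.log (z / (ρ * dir θ))).re *
      M.h (θ + (Complex.log (z / (ρ * dir θ))).im) := by
  have h0 : (ρ : ℂ) * dir θ ≠ 0 := mul_ne_zero (by exact_mod_cast hρ.ne') (dir_ne_zero θ)
  filter_upwards [isOpen_ne.mem_nhds h0] with z hz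
  exact M.l_eq_exp_log hρ hz

lemma contDiffAt_l {z : ℂ} (hz : z ≠ 0) : ContDiffAt ℝ ∞ M.l z := by
  have hρ : 0 < ‖z‖ := norm_pos_iff.2 hz
  have e : (‖z‖ : ℂ) * dir z.arg = z := Complex.norm_mul_exp_arg_mul_I z
  have he := M.eventually_l_eq (θ := z.arg) hρ
  rw [e] at he
  refine ContDiffAt.congr_of_eventuallyEq ?_ he
  have hl : ContDiffAt ℝ ∞ (fun y : ℂ => Complex.log (y / z)) z := by
    have h1 : ContDiffAt ℂ ∞ Complex.log (z / z) := by
      rw [div_self hz]; exact Complex.contDiffAt_log Complex.one_mem_slitPlane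
    exact ContDiffAt.comp (f := fun y : ℂ => y / z) z (h1.restrict_scalars ℝ)
      (contDiffAt_id.div_const z)
  have hre := Complex.reCLM.contDiff.contDiffAt.comp z hl
  have him := Complex.imCLM.contDiff.contDiffAt.comp z hl
  exact (contDiffAt_const.mul hre.exp).mul
    (M.contDiff_h.contDiffAt.comp z (contDiffAt_const.add him))

/-- The differential of `l` at `ρτ` is `h⟨τ,·⟩ + h_θ⟨n,·⟩`; multiplication by `conj τ` reads off
both coordinates. -/
lemma hasDerivAt_l_comp {c : ℝ → ℂ} {w : ℂ} {s ρ θ : ℝ} (hρ : 0 < ρ) (hc : HasDerivAt c w s)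
    (hs : c s = ρ * dir θ) :
    HasDerivAt (fun t => M.l (c t)) (M.h θ * ((starRingEnd ℂ) (dir θ) * w).re +
      deriv M.h θ * ((starRingEnd ℂ) (dir θ) * w).im) s := by
  have h0 : (ρ : ℂ) * dir θ ≠ 0 := mul_ne_zero (by exact_mod_cast hρ.ne') (dir_ne_zero θ)
  have he := M.eventually_l_eq (θ := θ) hρ
  rw [← hs] at he
  have he2 := hc.continuousAt.eventually he
  refine HasDerivAt.congr_of_eventuallyEq ?_ he2
  have hdiv : c s / c s = 1 := div_self (hs ▸ h0)
  have hlog : HasDerivAt (fun t => Complex.log (c t / c s)) (w / c s) s := by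
    have := (hc.div_const (c s)).clog_real (by rw [hdiv]; exact Complex.one_mem_slitPlane)
    rwa [hdiv, div_one] at this
  have hre := Complex.reCLM.hasFDerivAt.comp_hasDerivAt s hlog
  have him := Complex.imCLM.hasFDerivAt.comp_hasDerivAt s hlog
  have hh : HasDerivAt M.h (deriv M.h θ) (θ + (Complex.log (c s / c s)).im) := by
    rw [hdiv]; simpa using M.contDiff_h.hasDerivAt_infty θ
  have := ((hre.exp.const_mul ρ).mul (hh.comp s (him.const_add θ)))
  refine this.congr_deriv ?_
  have hw : w / c s = (ρ⁻¹ : ℝ) * ((starRingEnd ℂ) (dir θ) * w) := by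
    rw [hs, div_eq_iff h0]
    have : (ρ : ℂ) ≠ 0 := by exact_mod_cast hρ.ne'
    push_cast
    have h1 := conj_dir_mul_dir θ
    field_simp
    linear_combination - w * h1
  simp only [Function.comp, hdiv, hw, Complex.reCLM_apply, Complex.imCLM_apply, Complex.log_one,
    Complex.re_ofReal_mul, Complex.im_ofReal_mul]
  simp
  field_simp

end MinkowskiPlane

/-! ### Smooth tangent angles. -/

/-- A smooth choice `θ` of the tangent angle along `γ`. -/
structure IsAngleLift (γ : ℝ → ℂ) (θ : ℝ → ℝ) : Prop where
  smooth : ContDiff ℝ ∞ θ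
  deriv_eq : ∀ u, deriv γ u = (‖deriv γ u‖ : ℂ) * dir (θ u)

lemma IsClosedImmersion.norm_pos {γ : ℝ → ℂ} (hγ : IsClosedImmersion γ) (u : ℝ) :
    0 < ‖deriv γ u‖ := norm_pos_iff.2 (hγ.immersed u)

lemma IsClosedImmersion.contDiff_norm {γ : ℝ → ℂ} (hγ : IsClosedImmersion γ) :
    ContDiff ℝ ∞ fun u => ‖deriv γ u‖ :=
  hγ.smooth.deriv_infty.norm ℝ hγ.immersed

lemma IsClosedImmersion.exists_isAngleLift {γ : ℝ → ℂ} (hγ : IsClosedImmersion γ) :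
    ∃ θ, IsAngleLift γ θ := by
  set g := deriv γ with hg
  have hgs : ContDiff ℝ ∞ g := hγ.smooth.deriv_infty
  have hg0 : ∀ u, g u ≠ 0 := hγ.immersed
  have hφ : ContDiff ℝ ∞ fun u => deriv g u / g u := by
    simp only [div_eq_mul_inv]
    exact hgs.deriv_infty.mul (hgs.inv hg0)
  -- Integrating the logarithmic derivative gives a global smooth logarithm of `γ_u`; its imaginary
  -- part is the angle.
  set Ψ : ℝ → ℂ := fun u => Complex.log (g 0) + ∫ s in (0 : ℝ)..u, deriv g s / g s with hΨ
  have hΨd : ∀ u, HasDerivAt Ψ (deriv g u / g u) u := fun u =>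
    (intervalIntegral.integral_hasDerivAt_right (hφ.continuous.intervalIntegrable _ _)
      (hφ.continuous.stronglyMeasurableAtFilter _ _) hφ.continuous.continuousAt).const_add _
  have hΨs : ContDiff ℝ ∞ Ψ := by
    refine contDiff_infty_iff_deriv.2 ⟨fun u => (hΨd u).differentiableAt, ?_⟩
    rw [show deriv Ψ = fun u => deriv g u / g u from funext fun u => (hΨd u).deriv]
    exact hφ
  have hc : ∀ u, g u * Complex.exp (-Ψ u) = 1 := by
    have hd : ∀ u, HasDerivAt (fun u => g u * Complex.exp (-Ψ u)) 0 u := fun u => by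
      refine ((hgs.hasDerivAt_infty u).mul (hΨd u).neg.cexp).congr_deriv ?_
      have := hg0 u
      simp only [Pi.neg_apply]
      field_simp
      ring
    intro u
    rw [is_const_of_deriv_eq_zero (fun u => (hd u).differentiableAt) (fun u => (hd u).deriv) u 0]
    simp only [hΨ, intervalIntegral.integral_same, add_zero, Complex.exp_neg,
      Complex.exp_log (hg0 0)]
    exact mul_inv_cancel₀ (hg0 0)
  have he : ∀ u, g u = Complex.exp (Ψ u) := fun u => by
    rw [← one_mul (Complex.exp (Ψ u)), ← hc u, mul_assoc, ← Complex.exp_add]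
    simp
  refine ⟨fun u => (Ψ u).im, Complex.imCLM.contDiff.comp hΨs, fun u => ?_⟩
  rw [← hg, he, Complex.norm_exp, dir, Complex.ofReal_exp, ← Complex.exp_add, Complex.re_add_im]

namespace IsAngleLift

variable {γ : ℝ → ℂ} {θ : ℝ → ℝ} (hθ : IsAngleLift γ θ) (hγ : IsClosedImmersion γ)

include hθ hγ

lemma deriv_deriv (u : ℝ) : deriv (deriv γ) u =
    ((deriv (fun u => ‖deriv γ u‖) u : ℝ) + (‖deriv γ u‖ * deriv θ u : ℝ) * Complex.I) *
      dir (θ u) := by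
  have h1 := (hγ.contDiff_norm.hasDerivAt_infty u).ofReal_comp
  have h2 := (hasDerivAt_dir (θ u)).scomp u (hθ.smooth.hasDerivAt_infty u)
  have e : deriv γ = fun u => (‖deriv γ u‖ : ℂ) * dir (θ u) := funext hθ.deriv_eq
  conv_lhs => rw [e]
  refine (h1.mul h2).deriv.trans ?_
  simp only [Function.comp, Complex.real_smul]
  push_cast
  ring

lemma euclideanCurvature_eq (u : ℝ) : euclideanCurvature γ u = deriv θ u / ‖deriv γ u‖ := by
  have hv := (hγ.norm_pos u).ne'
  rw [euclideanCurvature, hθ.deriv_deriv hγ, div_eq_div_iff (pow_ne_zero _ hv) hv]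
  have h1 : (deriv γ u).re = ‖deriv γ u‖ * Real.cos (θ u) := by
    conv_lhs => rw [hθ.deriv_eq u]
    simp
  have h2 : (deriv γ u).im = ‖deriv γ u‖ * Real.sin (θ u) := by
    conv_lhs => rw [hθ.deriv_eq u]
    simp
  rw [h1, h2]
  simp
  linear_combination (‖deriv γ u‖ ^ 3 * deriv θ u) * Real.sin_sq_add_cos_sq (θ u)

/-- Expresses `θ_u` without choosing a lift, so that the turning number is visibly continuous in
time. -/
lemma im_deriv_deriv_div (u : ℝ) : (deriv (deriv γ) u / deriv γ u).im = deriv θ u := by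
  have hv := (hγ.norm_pos u).ne'
  have hv' : (‖deriv γ u‖ : ℂ) ≠ 0 := by exact_mod_cast hv
  have : deriv (deriv γ) u / deriv γ u =
      ((deriv (fun u => ‖deriv γ u‖) u / ‖deriv γ u‖ : ℝ) : ℂ) + (deriv θ u : ℝ) * Complex.I := by
    rw [div_eq_iff (hγ.immersed u), hθ.deriv_deriv hγ]
    rw [mul_comm _ (deriv γ u)]
    conv_rhs => arg 1; rw [hθ.deriv_eq u]
    push_cast
    field_simp
  rw [this]
  simp

lemma dir_tangentAngle (u : ℝ) : dir (tangentAngle γ u) = dir (θ u) := by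
  have h1 := Complex.norm_mul_exp_arg_mul_I (deriv γ u)
  rw [hθ.deriv_eq u, norm_mul, norm_dir, mul_one, Complex.norm_real, norm_norm] at h1
  refine mul_left_cancel₀ (by exact_mod_cast (hγ.norm_pos u).ne' : (‖deriv γ u‖ : ℂ) ≠ 0) ?_
  rw [tangentAngle, hθ.deriv_eq u, norm_mul, norm_dir, mul_one, Complex.norm_real, norm_norm]
  exact h1

lemma exists_int : ∃ n : ℤ, θ (2 * π) = θ 0 + n * (2 * π) := by
  apply exists_int_of_dir_eq
  have h1 := hθ.deriv_eq (2 * π)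
  have h2 : deriv γ (2 * π) = deriv γ 0 := by
    simpa using hγ.periodic.deriv 0
  rw [h2, hθ.deriv_eq 0, norm_mul, norm_dir, mul_one, Complex.norm_real, norm_norm] at h1
  exact (mul_left_cancel₀
    (by exact_mod_cast (hγ.norm_pos 0).ne' : (‖deriv γ 0‖ : ℂ) ≠ 0) h1).symm

variable (M : MinkowskiPlane)

lemma l_deriv (u : ℝ) : M.l (deriv γ u) = ‖deriv γ u‖ * M.h (θ u) := by
  conv_lhs => rw [hθ.deriv_eq u]
  exact M.l_mul_dir (hγ.norm_pos u) _

lemma curvature_eq (u : ℝ) : M.curvature γ u = deriv θ u / ‖deriv γ u‖ * M.q (θ u) := by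
  rw [← M.q_periodic.eq_of_dir_eq (hθ.dir_tangentAngle hγ u), ← hθ.euclideanCurvature_eq hγ]
  rfl

/-- The speed cancels: `κ dσ` is the pullback of a fixed form on the circle of directions. -/
lemma curvature_mul_l (u : ℝ) :
    M.curvature γ u * M.l (deriv γ u) = M.h (θ u) * M.q (θ u) * deriv θ u := by
  rw [hθ.curvature_eq hγ, hθ.l_deriv hγ]
  have := hγ.norm_pos u
  field_simp

lemma N_tangentAngle (u : ℝ) : M.N (tangentAngle γ u) = M.N (θ u) :=
  M.N_periodic.eq_of_dir_eq (hθ.dir_tangentAngle hγ u)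

end IsAngleLift

/-! ### Calculus in Minkowski arc length and total curvature. -/

namespace MinkowskiPlane

variable (M : MinkowskiPlane) {γ : ℝ → ℂ} (hγ : IsClosedImmersion γ)

section
include hγ

lemma contDiff_l_deriv : ContDiff ℝ ∞ fun u => M.l (deriv γ u) :=
  contDiff_iff_contDiffAt.2 fun u =>
    (M.contDiffAt_l (hγ.immersed u)).comp u hγ.smooth.deriv_infty.contDiffAt

lemma l_deriv_pos (u : ℝ) : 0 < M.l (deriv γ u) := M.l_pos (hγ.immersed u)

lemma l_deriv_periodic : Function.Periodic (fun u => M.l (deriv γ u)) (2 * π) :=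
  fun u => congrArg M.l (hγ.periodic.deriv u)

lemma length_pos : 0 < M.length γ :=
  intervalIntegral.intervalIntegral_pos_of_pos
    ((M.contDiff_l_deriv hγ).continuous.intervalIntegrable _ _) (M.l_deriv_pos hγ) (by positivity)

lemma contDiff_dσ {f : ℝ → ℝ} (hf : ContDiff ℝ ∞ f) : ContDiff ℝ ∞ (M.dσ γ f) :=
  hf.deriv_infty.div (M.contDiff_l_deriv hγ) fun u => (M.l_deriv_pos hγ u).ne'

lemma dσ_periodic {f : ℝ → ℝ} (hf : Function.Periodic f (2 * π)) :
    Function.Periodic (M.dσ γ f) (2 * π) :=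
  fun u => congrArg₂ (· / ·) (hf.deriv u) (M.l_deriv_periodic hγ u)

lemma dσ_mul_l (f : ℝ → ℝ) (u : ℝ) : M.dσ γ f u * M.l (deriv γ u) = deriv f u :=
  div_mul_cancel₀ _ (M.l_deriv_pos hγ u).ne'

lemma contDiff_dσ_iterate {f : ℝ → ℝ} (hf : ContDiff ℝ ∞ f) (m : ℕ) :
    ContDiff ℝ ∞ ((M.dσ γ)^[m] f) := by
  induction m with
  | zero => exact hf
  | succ m ih => rw [Function.iterate_succ_apply']; exact M.contDiff_dσ hγ ih

lemma dσ_iterate_periodic {f : ℝ → ℝ} (hf : Function.Periodic f (2 * π)) (m : ℕ) :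
    Function.Periodic ((M.dσ γ)^[m] f) (2 * π) := by
  induction m with
  | zero => exact hf
  | succ m ih => rw [Function.iterate_succ_apply']; exact M.dσ_periodic hγ ih

lemma contDiff_curvature : ContDiff ℝ ∞ (M.curvature γ) := by
  obtain ⟨θ, hθ⟩ := hγ.exists_isAngleLift
  rw [show M.curvature γ = fun u => deriv θ u / ‖deriv γ u‖ * M.q (θ u) from
    funext (hθ.curvature_eq hγ M)]
  exact (hθ.smooth.deriv_infty.div hγ.contDiff_norm fun u => (hγ.norm_pos u).ne').mul
    (M.contDiff_q.comp hθ.smooth)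

lemma curvature_periodic : Function.Periodic (M.curvature γ) (2 * π) := by
  intro u
  simp only [curvature, euclideanCurvature, tangentAngle, hγ.periodic.deriv u,
    hγ.periodic.deriv.deriv u]

lemma contDiff_curvatureDeriv (m : ℕ) : ContDiff ℝ ∞ (M.curvatureDeriv γ m) :=
  M.contDiff_dσ_iterate hγ (M.contDiff_curvature hγ) m

lemma curvatureDeriv_periodic (m : ℕ) : Function.Periodic (M.curvatureDeriv γ m) (2 * π) :=
  M.dσ_iterate_periodic hγ (M.curvature_periodic hγ) m

lemma integral_dσ {f : ℝ → ℝ} (hf : ContDiff ℝ ∞ f) (hfp : Function.Periodic f (2 * π)) :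
    M.integral γ (M.dσ γ f) = 0 := by
  simp only [integral, M.dσ_mul_l hγ]
  rw [intervalIntegral.integral_deriv_eq_sub (fun u _ => (hf.hasDerivAt_infty u).differentiableAt)
    (hf.deriv_infty.continuous.intervalIntegrable _ _)]
  have := hfp 0
  rw [zero_add] at this
  rw [this, sub_self]

lemma integral_dσ_mul {f g : ℝ → ℝ} (hf : ContDiff ℝ ∞ f) (hfp : Function.Periodic f (2 * π))
    (hg : ContDiff ℝ ∞ g) (hgp : Function.Periodic g (2 * π)) :
    M.integral γ (fun u => M.dσ γ f u * g u) = - M.integral γ (fun u => f u * M.dσ γ g u) := by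
  have h := M.integral_dσ hγ (hf.mul hg) (fun u => congrArg₂ (· * ·) (hfp u) (hgp u))
  have e : M.dσ γ (fun u => f u * g u) = fun u => M.dσ γ f u * g u + f u * M.dσ γ g u := by
    funext u
    rw [dσ, ((hf.hasDerivAt_infty u).fun_mul (hg.hasDerivAt_infty u)).deriv]
    simp only [dσ]
    ring
  have hl := (M.contDiff_l_deriv hγ).continuous
  have hfc := (M.contDiff_dσ hγ hf).continuous
  have hgc := (M.contDiff_dσ hγ hg).continuous
  change M.integral γ (M.dσ γ (fun u => f u * g u)) = 0 at h
  rw [e] at h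
  simp only [integral, add_mul] at h ⊢
  have hs := intervalIntegral.integral_add (μ := volume) (a := 0) (b := 2 * π)
    (((hfc.mul hg.continuous).mul hl).intervalIntegrable _ _)
    (((hf.continuous.mul hgc).mul hl).intervalIntegrable _ _)
  simp only [Pi.mul_apply] at hs
  linarith

lemma integral_mul_dσ_iterate {f g : ℝ → ℝ} (hf : ContDiff ℝ ∞ f)
    (hfp : Function.Periodic f (2 * π)) (hg : ContDiff ℝ ∞ g)
    (hgp : Function.Periodic g (2 * π)) (m : ℕ) :
    M.integral γ (fun u => f u * (M.dσ γ)^[m] g u) =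
      (-1) ^ m * M.integral γ (fun u => (M.dσ γ)^[m] f u * g u) := by
  induction m generalizing g with
  | zero => simp
  | succ m ih =>
    have h := M.integral_dσ_mul hγ (M.contDiff_dσ_iterate hγ hf m)
      (M.dσ_iterate_periodic hγ hfp m) hg hgp
    simp only [Function.iterate_succ_apply] at ih ⊢
    rw [ih (M.contDiff_dσ hγ hg) (M.dσ_periodic hγ hgp)]
    simp only [← Function.iterate_succ_apply, Function.iterate_succ_apply'] at h ⊢
    rw [h]
    ring

/-- Integrating by parts `p` times produces the sign `(-1)^p` which, combined with that of the flow,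
makes the length decrease. -/
lemma integral_curvature_mul_curvatureDeriv (p : ℕ) :
    M.integral γ (fun u => M.curvature γ u * M.curvatureDeriv γ (2 * p) u) =
      (-1) ^ p * M.integral γ (fun u => M.curvatureDeriv γ p u ^ 2) := by
  have hc := M.contDiff_curvature hγ
  have hp := M.curvature_periodic hγ
  have h := M.integral_mul_dσ_iterate hγ hc hp (M.contDiff_curvatureDeriv hγ p)
    (M.curvatureDeriv_periodic hγ p) p
  simp only [curvatureDeriv, ← Function.iterate_add_apply, ← two_mul] at h ⊢
  rw [h]
  simp only [sq]

lemma integral_curvatureDeriv {m : ℕ} (hm : 1 ≤ m) :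
    M.integral γ (M.curvatureDeriv γ m) = 0 := by
  obtain ⟨k, rfl⟩ := Nat.exists_eq_add_of_le' hm
  rw [curvatureDeriv, Function.iterate_succ_apply']
  exact M.integral_dσ hγ (M.contDiff_curvatureDeriv hγ k) (M.curvatureDeriv_periodic hγ k)

/-- The total curvature is quantised by the turning number of the curve. -/
lemma exists_turning_number : ∃ n : ℤ,
    ∫ u in (0 : ℝ)..(2 * π), (deriv (deriv γ) u / deriv γ u).im = n * (2 * π) ∧
      M.integral γ (M.curvature γ) = n * (2 * M.isoperimetrixArea) := by
  obtain ⟨θ, hθ⟩ := hγ.exists_isAngleLift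
  obtain ⟨n, hn⟩ := hθ.exists_int hγ
  refine ⟨n, ?_, ?_⟩
  · simp only [hθ.im_deriv_deriv_div hγ]
    rw [intervalIntegral.integral_deriv_eq_sub
      (fun u _ => (hθ.smooth.hasDerivAt_infty u).differentiableAt)
      (hθ.smooth.deriv_infty.continuous.intervalIntegrable _ _), hn]
    ring
  · simp only [integral, hθ.curvature_mul_l hγ]
    have hc : Continuous fun t => M.h t * M.q t :=
      M.contDiff_h.continuous.mul M.contDiff_q.continuous
    refine (intervalIntegral.integral_comp_mul_deriv (f := θ) (g := fun t => M.h t * M.q t)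
      (fun u _ => hθ.smooth.hasDerivAt_infty u)
      hθ.smooth.deriv_infty.continuous.continuousOn hc).trans ?_
    rw [hn]
    have hp : Function.Periodic (fun t => M.h t * M.q t) (2 * π) :=
      fun t => congrArg₂ (· * ·) (M.h_periodic t) (M.q_periodic t)
    have := hp.intervalIntegral_add_zsmul_eq n (θ 0) (fun a b => hc.intervalIntegrable _ _)
    rw [zsmul_eq_mul] at this
    rw [this, M.isoperimetrixArea_eq, hp.intervalIntegral_add_eq (θ 0) 0]
    simp

end

end MinkowskiPlane

/-! ### Cauchy–Schwarz and the oscillation of curvature. -/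

/-- The quadratic `c ↦ ∫ (c - f)² w` is nonnegative, so its discriminant is not positive. -/
lemma sq_integral_mul_le {f w : ℝ → ℝ} {a b : ℝ} (hab : a ≤ b) (hf : Continuous f)
    (hw : Continuous w) (hw0 : ∀ x, 0 ≤ w x) :
    (∫ x in a..b, f x * w x) ^ 2 ≤ (∫ x in a..b, w x) * ∫ x in a..b, f x ^ 2 * w x := by
  set A := ∫ x in a..b, w x
  set B := ∫ x in a..b, f x * w x
  set C := ∫ x in a..b, f x ^ 2 * w x
  have key : ∀ c : ℝ, 0 ≤ A * (c * c) + (-2 * B) * c + C := fun c => by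
    have h0 : 0 ≤ ∫ x in a..b, (c - f x) ^ 2 * w x :=
      intervalIntegral.integral_nonneg hab fun x _ => mul_nonneg (sq_nonneg _) (hw0 x)
    have e : ∀ x, (c - f x) ^ 2 * w x = (c * c) * w x + ((-2 * c) * (f x * w x) + f x ^ 2 * w x) :=
      fun x => by ring
    simp only [e] at h0
    rw [intervalIntegral.integral_add, intervalIntegral.integral_add,
      intervalIntegral.integral_const_mul, intervalIntegral.integral_const_mul] at h0
    · linarith
    all_goals exact Continuous.intervalIntegrable (by fun_prop) _ _
  have := discrim_le_zero key
  rw [discrim] at this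
  linarith

namespace MinkowskiPlane

variable (M : MinkowskiPlane) {γ : ℝ → ℂ} (hγ : IsClosedImmersion γ)

include hγ

lemma sq_integral_abs_le {f : ℝ → ℝ} (hf : Continuous f) :
    M.integral γ (fun u => |f u|) ^ 2 ≤ M.length γ * M.integral γ (fun u => f u ^ 2) := by
  have := sq_integral_mul_le (a := 0) (b := 2 * π) (by positivity) hf.abs
    (M.contDiff_l_deriv hγ).continuous fun u => (M.l_deriv_pos hγ u).le
  simpa only [integral, length, sq_abs] using this

lemma meanCurvature_mul_length :
    M.meanCurvature γ * M.length γ = M.integral γ (M.curvature γ) := by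
  rw [meanCurvature]
  have := M.length_pos hγ
  field_simp

lemma integral_curvature_sub_mean :
    M.integral γ (fun u => M.curvature γ u - M.meanCurvature γ) = 0 := by
  have hl := (M.contDiff_l_deriv hγ).continuous
  have hc := (M.contDiff_curvature hγ).continuous
  simp only [integral, sub_mul]
  rw [intervalIntegral.integral_sub, intervalIntegral.integral_const_mul]
  · exact sub_eq_zero.2 (M.meanCurvature_mul_length hγ).symm
  all_goals exact Continuous.intervalIntegrable (by fun_prop) _ _

/-- A curve of small oscillation of curvature is close to a multiple of the isoperimetrix, with
the matching sign of the enclosed area. -/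
lemma length_sub_le {m : ℝ} (hm : 0 < m) (hmh : ∀ θ, m ≤ M.h θ) :
    M.length γ - 2 * M.meanCurvature γ * enclosedArea γ ≤
      √(M.kosc γ) / m ^ 2 * M.length γ := by
  obtain ⟨θ, hθ⟩ := hγ.exists_isAngleLift
  set c := M.meanCurvature γ with hc
  have hκ := (M.contDiff_curvature hγ).continuous
  have hl := (M.contDiff_l_deriv hγ).continuous
  have hγ' := hγ.smooth.deriv_infty.continuous
  -- Since `N(θ)_u = -κ γ_u`, this field has derivative `-(κ - κ̄) γ_u`: it would be constant on a
  -- homothetic copy of the isoperimetrix.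
  set v : ℝ → ℂ := fun u => M.N (θ u) + c * γ u with hvdef
  set v' : ℝ → ℂ := fun u => -((M.curvature γ u - c : ℝ) : ℂ) * deriv γ u with hv'def
  have hvd : ∀ u, HasDerivAt v (v' u) u := fun u => by
    refine (((M.hasDerivAt_N (θ u)).scomp u (hθ.smooth.hasDerivAt_infty u)).add
      ((hγ.smooth.hasDerivAt_infty u).const_mul (c : ℂ))).congr_deriv ?_
    have hn : (‖deriv γ u‖ : ℂ) ≠ 0 := by exact_mod_cast (hγ.norm_pos u).ne'
    simp only [hv'def, hθ.curvature_eq hγ, Complex.real_smul]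
    push_cast
    have h1 : deriv γ u / (‖deriv γ u‖ : ℂ) = dir (θ u) := by
      rw [div_eq_iff hn, mul_comm]
      exact hθ.deriv_eq u
    linear_combination (((deriv θ u : ℝ) : ℂ) * M.q (θ u)) * h1
  have hv'c : Continuous v' := by
    simp only [hv'def]
    exact (Complex.continuous_ofReal.comp (hκ.sub continuous_const)).neg.mul hγ'
  have hml : ∀ u, ‖deriv γ u‖ ≤ M.l (deriv γ u) / m := fun u => by
    rw [le_div_iff₀ hm, hθ.l_deriv hγ]
    exact mul_le_mul_of_nonneg_left (hmh _) (norm_nonneg _)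
  have hS : M.integral γ (fun u => |M.curvature γ u - c|) ≤ √(M.kosc γ) :=
    Real.le_sqrt_of_sq_le (M.sq_integral_abs_le hγ (hκ.sub continuous_const))
  have hbound : ∀ u ∈ Set.Icc 0 (2 * π), ‖v u - v 0‖ ≤ √(M.kosc γ) / m := fun u hu => by
    rw [← intervalIntegral.integral_eq_sub_of_hasDerivAt (fun x _ => hvd x)
      (hv'c.intervalIntegrable _ _)]
    calc ‖∫ x in (0 : ℝ)..u, v' x‖ ≤ ∫ x in (0 : ℝ)..u, ‖v' x‖ :=
          intervalIntegral.norm_integral_le_integral_norm hu.1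
      _ ≤ ∫ x in (0 : ℝ)..(2 * π), ‖v' x‖ :=
          intervalIntegral.integral_mono_interval le_rfl hu.1 hu.2
            (Filter.Eventually.of_forall fun x => norm_nonneg _)
            (hv'c.norm.intervalIntegrable _ _)
      _ ≤ ∫ x in (0 : ℝ)..(2 * π), |M.curvature γ x - c| * M.l (deriv γ x) / m := by
          refine intervalIntegral.integral_mono_on (by positivity)
            (hv'c.norm.intervalIntegrable _ _)
            (Continuous.intervalIntegrable (by fun_prop) _ _) fun x _ => ?_
          simp only [hv'def]
          rw [norm_mul, norm_neg, Complex.norm_real, Real.norm_eq_abs, mul_div_assoc]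
          exact mul_le_mul_of_nonneg_left (hml x) (abs_nonneg _)
      _ = M.integral γ (fun u => |M.curvature γ u - c|) / m :=
          intervalIntegral.integral_div _ _
      _ ≤ √(M.kosc γ) / m := by gcongr
  -- Pairing `v` with `γ_u` produces length minus `κ̄` times the area form. Subtracting the constant
  -- `v 0` costs nothing after integration, because the curve is closed.
  have e1 : ∀ u, M.l (deriv γ u) + c * ((starRingEnd ℂ) (γ u) * deriv γ u).im * (-1) =
      -((starRingEnd ℂ) (v u - v 0) * deriv γ u).im -
        ((starRingEnd ℂ) (v 0) * deriv γ u).im := fun u => by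
    have h1 : ((starRingEnd ℂ) (M.N (θ u)) * deriv γ u).im = - M.l (deriv γ u) := by
      rw [hθ.l_deriv hγ]
      conv_lhs => rw [hθ.deriv_eq u]
      rw [mul_left_comm, Complex.im_ofReal_mul, M.im_conj_N_mul_dir]
      ring
    have h2 : (starRingEnd ℂ) (v u) * deriv γ u = (starRingEnd ℂ) (M.N (θ u)) * deriv γ u +
        (c : ℂ) * ((starRingEnd ℂ) (γ u) * deriv γ u) := by
      simp only [hvdef, map_add, map_mul, Complex.conj_ofReal]
      ring
    rw [map_sub, sub_mul, Complex.sub_im, h2, Complex.add_im, Complex.im_ofReal_mul, h1]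
    ring
  have hclosed : ∫ u in (0 : ℝ)..(2 * π), ((starRingEnd ℂ) (v 0) * deriv γ u).im = 0 := by
    have hd : ∀ u, HasDerivAt (fun u => ((starRingEnd ℂ) (v 0) * γ u).im)
        ((starRingEnd ℂ) (v 0) * deriv γ u).im u := fun u =>
      Complex.imCLM.hasFDerivAt.comp_hasDerivAt u
        ((hγ.smooth.hasDerivAt_infty u).const_mul ((starRingEnd ℂ) (v 0)))
    rw [intervalIntegral.integral_eq_sub_of_hasDerivAt (fun u _ => hd u)
      (Continuous.intervalIntegrable (by fun_prop) _ _)]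
    have := hγ.periodic 0
    rw [zero_add] at this
    rw [this, sub_self]
  have hvc : Continuous v := continuous_iff_continuousAt.2 fun u => (hvd u).continuousAt
  have hγc := hγ.smooth.continuous
  have hconj := Complex.continuous_conj
  have hI : M.length γ - 2 * c * enclosedArea γ =
      ∫ u in (0 : ℝ)..(2 * π), -((starRingEnd ℂ) (v u - v 0) * deriv γ u).im := by
    have h3 := congrArg (fun f : ℝ → ℝ => ∫ u in (0 : ℝ)..(2 * π), f u) (funext e1)
    beta_reduce at h3
    rw [intervalIntegral.integral_add, intervalIntegral.integral_sub, hclosed,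
      intervalIntegral.integral_mul_const, intervalIntegral.integral_const_mul] at h3
    · rw [enclosedArea_eq, length]
      linarith
    all_goals exact Continuous.intervalIntegrable (by fun_prop) _ _
  rw [hI]
  calc ∫ u in (0 : ℝ)..(2 * π), -((starRingEnd ℂ) (v u - v 0) * deriv γ u).im
      ≤ ∫ u in (0 : ℝ)..(2 * π), √(M.kosc γ) / m ^ 2 * M.l (deriv γ u) := by
        refine intervalIntegral.integral_mono_on (by positivity)
          (Continuous.intervalIntegrable (by fun_prop) _ _)
          (Continuous.intervalIntegrable (by fun_prop) _ _) fun u hu => ?_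
        calc -((starRingEnd ℂ) (v u - v 0) * deriv γ u).im
            ≤ ‖(starRingEnd ℂ) (v u - v 0) * deriv γ u‖ :=
              (neg_le_abs _).trans (Complex.abs_im_le_norm _)
          _ = ‖v u - v 0‖ * ‖deriv γ u‖ := by rw [norm_mul, RCLike.norm_conj]
          _ ≤ (√(M.kosc γ) / m) * (M.l (deriv γ u) / m) :=
              mul_le_mul (hbound u hu) (hml u) (norm_nonneg _) (by positivity)
          _ = √(M.kosc γ) / m ^ 2 * M.l (deriv γ u) := by ring
    _ = √(M.kosc γ) / m ^ 2 * M.length γ := intervalIntegral.integral_const_mul _ _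

/-- The threshold `m ^ 4` makes `√K_osc / m² < 1`, so `length_sub_le` leaves `κ̄ 𝒜 > 0`. -/
lemma meanCurvature_pos {m : ℝ} (hm : 0 < m) (hmh : ∀ θ, m ≤ M.h θ) (hA : 0 < enclosedArea γ)
    (hk : M.kosc γ < m ^ 4) : 0 < M.meanCurvature γ := by
  have h1 := M.length_sub_le hγ hm hmh
  have h2 : √(M.kosc γ) < m ^ 2 := by
    rw [Real.sqrt_lt' (by positivity)]
    calc _ < m ^ 4 := hk
      _ = _ := by ring
  have h3 : √(M.kosc γ) / m ^ 2 < 1 := (div_lt_one (by positivity)).2 h2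
  have h4 := mul_lt_of_lt_one_left (M.length_pos hγ) h3
  have h5 : 0 < M.meanCurvature γ * enclosedArea γ := by linarith
  exact (pos_iff_pos_of_mul_pos h5).2 hA

/-- If the curvature is somewhere nonpositive, the oscillation forces `κ_σ` to be large. -/
lemma four_mul_sq_meanCurvature_le (hpos : 0 ≤ M.meanCurvature γ) {u₀ : ℝ}
    (hu₀ : M.curvature γ u₀ ≤ 0) :
    4 * M.meanCurvature γ ^ 2 ≤
      M.length γ * M.integral γ (fun u => M.curvatureDeriv γ 1 u ^ 2) := by
  have hκ := M.contDiff_curvature hγ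
  have hl := (M.contDiff_l_deriv hγ).continuous
  set c := M.meanCurvature γ with hc
  obtain ⟨u₁, hu₁⟩ : ∃ u₁, c ≤ M.curvature γ u₁ := by
    by_contra! hlt
    have := intervalIntegral.intervalIntegral_pos_of_pos (a := 0) (b := 2 * π)
      (f := fun u => (c - M.curvature γ u) * M.l (deriv γ u))
      (Continuous.intervalIntegrable
        ((continuous_const.sub hκ.continuous).mul hl) _ _)
      (fun u => mul_pos (sub_pos.2 (hlt u)) (M.l_deriv_pos hγ u)) (by positivity)
    have h0 := M.integral_curvature_sub_mean hγ
    rw [integral] at h0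
    have e : ∀ u, (c - M.curvature γ u) * M.l (deriv γ u) =
      -((M.curvature γ u - c) * M.l (deriv γ u)) := fun u => by ring
    simp only [e, intervalIntegral.integral_neg] at this
    linarith
  have hκp := M.curvature_periodic hγ
  obtain ⟨u₂, hu₂, e₂⟩ := hκp.exists_mem_Ico (by positivity : 0 < 2 * π) u₁ u₀
  rw [e₂] at hu₁
  have hdc : Continuous fun u => |deriv (M.curvature γ) u| := hκ.deriv_infty.continuous.abs
  have hvar : ∀ a b, a ≤ b → |M.curvature γ b - M.curvature γ a| ≤
      ∫ u in a..b, |deriv (M.curvature γ) u| := fun a b hab => by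
    rw [← intervalIntegral.integral_eq_sub_of_hasDerivAt (fun x _ => hκ.hasDerivAt_infty x)
      (hκ.deriv_infty.continuous.intervalIntegrable _ _)]
    exact intervalIntegral.abs_integral_le_integral_abs hab
  -- The rise from `κ ≤ 0` to `κ ≥ κ̄` and the return each cost at least `κ̄` of variation; hence
  -- `2κ̄`, and `4κ̄²` after squaring.
  have h1 := (abs_le.1 (hvar u₀ u₂ hu₂.1)).2
  have h2 := (abs_le.1 (hvar u₂ (u₀ + 2 * π) hu₂.2.le)).1
  rw [hκp u₀] at h2
  have h3 := intervalIntegral.integral_add_adjacent_intervals (μ := volume)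
    (hdc.intervalIntegrable u₀ u₂) (hdc.intervalIntegrable u₂ (u₀ + 2 * π))
  have hper : Function.Periodic (fun u => |deriv (M.curvature γ) u|) (2 * π) :=
    fun u => congrArg abs (hκp.deriv u)
  rw [hper.intervalIntegral_add_eq u₀ 0, zero_add] at h3
  have h4 : ∫ u in (0 : ℝ)..(2 * π), |deriv (M.curvature γ) u| =
      M.integral γ (fun u => |M.curvatureDeriv γ 1 u|) := by
    apply intervalIntegral.integral_congr
    intro u _
    have h := M.dσ_mul_l hγ (M.curvature γ) u
    simp only [curvatureDeriv, Function.iterate_one]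
    rw [← h, abs_mul, abs_of_pos (M.l_deriv_pos hγ u)]
  have h5 := M.sq_integral_abs_le hγ (M.contDiff_curvatureDeriv hγ 1).continuous
  have h6 : 2 * c ≤ M.integral γ (fun u => |M.curvatureDeriv γ 1 u|) := by linarith
  calc 4 * c ^ 2 = (2 * c) ^ 2 := by ring
    _ ≤ _ := pow_le_pow_left₀ (by positivity) h6 2
    _ ≤ _ := h5

end MinkowskiPlane

/-! ### Wirtinger inequalities. -/

/-- **Wirtinger's inequality** on a circle of length `L`. -/
lemma wirtinger {L : ℝ} (hL : 0 < L) {f f' : ℝ → ℝ} (hf : ∀ x, HasDerivAt f (f' x) x)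
    (hf' : Continuous f') (hper : f L = f 0) (hmean : ∫ x in (0 : ℝ)..L, f x = 0) :
    ∫ x in (0 : ℝ)..L, f x ^ 2 ≤ (L / (2 * π)) ^ 2 * ∫ x in (0 : ℝ)..L, f' x ^ 2 := by
  have hfc : Continuous f := continuous_iff_continuousAt.2 fun x => (hf x).continuousAt
  have hmem : ∀ g : ℝ → ℝ, Continuous g →
      MemLp (fun x => (g x : ℂ)) 2 (volume.restrict (Set.Ioc 0 L)) := fun g hg => by
    have hc := Complex.continuous_ofReal.comp hg
    exact (memLp_two_iff_integrable_sq_norm hc.aestronglyMeasurable).2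
      ((hc.norm.pow 2).integrableOn_Ioc)
  have h1 := hasSum_sq_fourierCoeffOn hL (hmem f hfc)
  have h2 := (hasSum_sq_fourierCoeffOn hL (hmem f' hf')).mul_left ((L / (2 * π)) ^ 2)
  -- By Parseval it suffices to compare Fourier coefficients: the zeroth vanishes by the mean
  -- condition, and for `n ≠ 0` differentiation multiplies by `2πin/L` with `|n| ≥ 1`.
  have hle : ∀ n : ℤ, ‖fourierCoeffOn hL (fun x => (f x : ℂ)) n‖ ^ 2 ≤
      (L / (2 * π)) ^ 2 * ‖fourierCoeffOn hL (fun x => (f' x : ℂ)) n‖ ^ 2 := by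
    intro n
    rcases eq_or_ne n 0 with rfl | hn
    · have : fourierCoeffOn hL (fun x => (f x : ℂ)) 0 = 0 := by
        rw [fourierCoeffOn_eq_integral]
        simp [intervalIntegral.integral_ofReal, hmean]
      rw [this]
      simp only [norm_zero, ne_eq, OfNat.ofNat_ne_zero, not_false_eq_true, zero_pow]
      positivity
    · rw [fourierCoeffOn_of_hasDerivAt hL hn (fun x _ => (hf x).ofReal_comp)
        ((Complex.continuous_ofReal.comp hf').intervalIntegrable _ _), hper, ← mul_pow]
      have hn1 : (1 : ℝ) ≤ |(n : ℝ)| := by exact_mod_cast Int.one_le_abs hn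
      gcongr
      simp only [sub_self, mul_zero, zero_sub, Complex.ofReal_zero, sub_zero, norm_mul, norm_neg,
        norm_div, norm_one, Complex.norm_I, mul_one, Complex.norm_real, Complex.norm_intCast,
        RCLike.norm_ofNat, Real.norm_eq_abs, abs_of_pos Real.pi_pos, abs_of_pos hL]
      rw [← mul_assoc]
      refine mul_le_mul_of_nonneg_right ?_ (norm_nonneg _)
      rw [div_mul_eq_mul_div, one_mul]
      exact div_le_div_of_nonneg_left hL.le (by positivity)
        (le_mul_of_one_le_right (by positivity) hn1)
  have h3 := hasSum_le hle h1 h2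
  simp only [sub_zero, smul_eq_mul, Complex.norm_real, Real.norm_eq_abs, sq_abs] at h3
  rw [mul_left_comm] at h3
  exact le_of_mul_le_mul_left h3 (inv_pos.2 hL)

/-- **Wirtinger's inequality** for a periodic length element `w`. -/
lemma wirtinger_weighted {f g w : ℝ → ℝ} {c : ℝ} (hc : 0 < c) (hw : Continuous w)
    (hw0 : ∀ u, 0 < w u) (hwp : Function.Periodic w c) (hg : Continuous g)
    (hf : ∀ u, HasDerivAt f (g u * w u) u) (hper : f c = f 0)
    (hmean : ∫ u in (0 : ℝ)..c, f u * w u = 0) :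
    ∫ u in (0 : ℝ)..c, f u ^ 2 * w u ≤
      ((∫ u in (0 : ℝ)..c, w u) / (2 * π)) ^ 2 * ∫ u in (0 : ℝ)..c, g u ^ 2 * w u := by
  have hwi : ∀ a b, IntervalIntegrable w volume a b := fun a b => hw.intervalIntegrable a b
  have hL : 0 < ∫ u in (0 : ℝ)..c, w u :=
    intervalIntegral.intervalIntegral_pos_of_pos (hwi _ _) hw0 hc
  -- Arc length as a new parameter reduces to the constant weight; periodicity and positivity of `w`
  -- make it a bijection of `ℝ`.
  set σ : ℝ → ℝ := fun u => ∫ x in (0 : ℝ)..u, w x with hσ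
  have hσd : ∀ u, HasDerivAt σ (w u) u := fun u =>
    intervalIntegral.integral_hasDerivAt_right (hwi _ _)
      (hw.stronglyMeasurableAtFilter _ _) hw.continuousAt
  have hσc : Continuous σ := continuous_iff_continuousAt.2 fun u => (hσd u).continuousAt
  have hσm : StrictMono σ := strictMono_of_deriv_pos fun u => by rw [(hσd u).deriv]; exact hw0 u
  have hσs : Function.Surjective σ :=
    hσc.surjective (hwp.tendsto_atTop_intervalIntegral_of_pos' (hwi _ _) hw0 hc)
      (hwp.tendsto_atBot_intervalIntegral_of_pos' (hwi _ _) hw0 hc)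
  set e := hσm.orderIsoOfSurjective σ hσs with he
  have hes : ∀ u, e.symm (σ u) = u := fun u => e.symm_apply_apply u
  have hse : ∀ x, σ (e.symm x) = x := fun x => e.apply_symm_apply x
  have hed : ∀ x, HasDerivAt e.symm (w (e.symm x))⁻¹ x := fun x =>
    HasDerivAt.of_local_left_inverse e.symm.continuous.continuousAt (hσd _) (hw0 _).ne'
      (Filter.Eventually.of_forall hse)
  have hec : Continuous e.symm := e.symm.continuous
  have hfc : Continuous f := continuous_iff_continuousAt.2 fun u => (hf u).continuousAt
  have hsub : ∀ k : ℝ → ℝ, Continuous k →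
      ∫ u in (0 : ℝ)..c, k u * w u = ∫ x in (0 : ℝ)..σ c, k (e.symm x) := fun k hk => by
    have := intervalIntegral.integral_comp_mul_deriv (a := 0) (b := c) (f := σ) (f' := w)
      (g := fun x => k (e.symm x)) (fun u _ => hσd u) hw.continuousOn (hk.comp hec)
    simp only [Function.comp, hes] at this
    rw [this]
    simp [hσ]
  have hF : ∀ x, HasDerivAt (fun x => f (e.symm x)) (g (e.symm x)) x := fun x => by
    refine ((hf _).comp x (hed x)).congr_deriv ?_
    have := (hw0 (e.symm x)).ne'
    field_simp
  have h0 : e.symm 0 = 0 := by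
    have := hes 0
    simpa [hσ] using this
  have := wirtinger (L := σ c) hL hF (hg.comp hec) (by rw [hes, h0, hper])
    (by rw [← hsub f hfc]; exact hmean)
  rw [hsub (fun u => f u ^ 2) (hfc.pow 2), hsub (fun u => g u ^ 2) (hg.pow 2)]
  exact this

namespace MinkowskiPlane

variable (M : MinkowskiPlane) {γ : ℝ → ℂ} (hγ : IsClosedImmersion γ)

include hγ

/-- For `m ≥ 1` the function is a `σ`-derivative of a periodic one, hence has mean zero. -/
lemma integral_sq_curvatureDeriv_le {m : ℕ} (hm : 1 ≤ m) :
    M.integral γ (fun u => M.curvatureDeriv γ m u ^ 2) ≤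
      (M.length γ / (2 * π)) ^ 2 * M.integral γ (fun u => M.curvatureDeriv γ (m + 1) u ^ 2) := by
  have hs := M.contDiff_curvatureDeriv hγ m
  refine wirtinger_weighted (f := M.curvatureDeriv γ m) (g := M.curvatureDeriv γ (m + 1))
    (by positivity) (M.contDiff_l_deriv hγ).continuous (M.l_deriv_pos hγ) (M.l_deriv_periodic hγ)
    (M.contDiff_curvatureDeriv hγ (m + 1)).continuous (fun u => ?_) ?_
    (M.integral_curvatureDeriv hγ hm)
  · refine (hs.hasDerivAt_infty u).congr_deriv ?_
    rw [← M.dσ_mul_l hγ, curvatureDeriv, curvatureDeriv, Function.iterate_succ_apply']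
  · have := M.curvatureDeriv_periodic hγ m 0
    rwa [zero_add] at this

lemma integral_sq_curvatureDeriv_one_le (k : ℕ) :
    M.integral γ (fun u => M.curvatureDeriv γ 1 u ^ 2) ≤
      (M.length γ / (2 * π)) ^ (2 * k) *
        M.integral γ (fun u => M.curvatureDeriv γ (k + 1) u ^ 2) := by
  induction k with
  | zero => simp
  | succ k ih =>
    refine ih.trans ?_
    have hL := M.length_pos hγ
    calc _ ≤ (M.length γ / (2 * π)) ^ (2 * k) * ((M.length γ / (2 * π)) ^ 2 *
          M.integral γ (fun u => M.curvatureDeriv γ (k + 1 + 1) u ^ 2)) := by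
          gcongr
          exact M.integral_sq_curvatureDeriv_le hγ (by omega)
      _ = _ := by ring

end MinkowskiPlane

/-! ### The isoperimetric inequality. -/

namespace MinkowskiPlane

variable (M : MinkowskiPlane)

lemma dir_add_pi (θ : ℝ) : dir (θ + π) = -dir θ := by
  rw [dir_eq, dir_eq, Real.cos_add_pi, Real.sin_add_pi]
  push_cast
  ring

lemma N_add_pi (θ : ℝ) : M.N (θ + π) = -M.N θ := by
  have h1 : Function.Periodic M.h π := M.h_add_pi
  rw [N_eq, N_eq, h1, h1.deriv, dir_add_pi]
  ring

lemma im_conj_dir_mul_N_self (θ : ℝ) : ((starRingEnd ℂ) (dir θ) * M.N θ).im = M.h θ := by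
  have := M.im_conj_N_mul_dir θ
  rw [← neg_inj, ← this, ← Complex.conj_im, map_mul, Complex.conj_conj, mul_comm]

lemma hasDerivAt_im_conj_dir_mul_N (θ φ : ℝ) :
    HasDerivAt (fun φ => ((starRingEnd ℂ) (dir θ) * M.N φ).im) (-M.q φ * Real.sin (φ - θ)) φ := by
  refine (Complex.imCLM.hasFDerivAt.comp_hasDerivAt φ
    ((M.hasDerivAt_N φ).const_mul ((starRingEnd ℂ) (dir θ)))).congr_deriv ?_
  rw [Real.sin_sub]
  simp
  ring

/-- The isoperimetrix lies in the strip of half-width `h θ` around the line of direction `θ`. -/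
lemma im_conj_dir_mul_N_le (θ φ : ℝ) : ((starRingEnd ℂ) (dir θ) * M.N φ).im ≤ M.h θ := by
  set f := fun φ => ((starRingEnd ℂ) (dir θ) * M.N φ).im with hf
  have hfd : ∀ φ, HasDerivAt f (-M.q φ * Real.sin (φ - θ)) φ := M.hasDerivAt_im_conj_dir_mul_N θ
  have hfc : Continuous f := continuous_iff_continuousAt.2 fun φ => (hfd φ).continuousAt
  have hfp : Function.Periodic f (2 * π) := fun φ => by simp only [hf, M.N_periodic φ]
  obtain ⟨φ', h', e⟩ := hfp.exists_mem_Ico (by positivity) φ (θ - π)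
  change f φ ≤ _
  rw [e, ← M.im_conj_dir_mul_N_self θ]
  change f φ' ≤ f θ
  -- As `f' = -q sin(φ - θ)` with `q > 0`, `f` rises on `[θ - π, θ]` and falls on `[θ, θ + π]`, so
  -- its maximum is at `θ`.
  rcases le_total φ' θ with hle | hle
  · have : MonotoneOn f (Set.Icc (θ - π) θ) := by
      refine monotoneOn_of_deriv_nonneg (convex_Icc _ _) hfc.continuousOn
        (fun x _ => (hfd x).differentiableAt.differentiableWithinAt) fun x hx => ?_
      rw [interior_Icc] at hx
      rw [(hfd x).deriv, neg_mul, ← mul_neg, ← Real.sin_neg]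
      exact mul_nonneg (M.q_pos x).le
        (Real.sin_nonneg_of_nonneg_of_le_pi (by linarith [hx.2]) (by linarith [hx.1]))
    exact this ⟨h'.1, hle⟩ ⟨by linarith [Real.pi_pos], le_rfl⟩ hle
  · have : AntitoneOn f (Set.Icc θ (θ + π)) := by
      refine antitoneOn_of_deriv_nonpos (convex_Icc _ _) hfc.continuousOn
        (fun x _ => (hfd x).differentiableAt.differentiableWithinAt) fun x hx => ?_
      rw [interior_Icc] at hx
      rw [(hfd x).deriv, neg_mul, neg_nonpos]
      exact mul_nonneg (M.q_pos x).le
        (Real.sin_nonneg_of_nonneg_of_le_pi (by linarith [hx.1]) (by linarith [hx.2]))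
    exact this ⟨le_rfl, by linarith [Real.pi_pos]⟩ ⟨hle, by linarith [h'.2]⟩ hle

lemma abs_im_conj_dir_mul_N_le (θ φ : ℝ) : |((starRingEnd ℂ) (dir θ) * M.N φ).im| ≤ M.h θ := by
  refine abs_le.2 ⟨?_, M.im_conj_dir_mul_N_le θ φ⟩
  have := M.im_conj_dir_mul_N_le θ (φ + π)
  rw [N_add_pi, mul_neg, Complex.neg_im] at this
  linarith

/-- Duality: up to rotation the isoperimetrix bounds the dual unit ball, so pairing any of its
points with a vector is at most the norm of the vector. -/
lemma abs_im_conj_N_mul_deriv_le {γ : ℝ → ℂ} (hγ : IsClosedImmersion γ) (u φ : ℝ) :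
    |((starRingEnd ℂ) (M.N φ) * deriv γ u).im| ≤ M.l (deriv γ u) := by
  obtain ⟨θ, hθ⟩ := hγ.exists_isAngleLift
  rw [hθ.l_deriv hγ]
  conv_lhs => rw [hθ.deriv_eq u]
  rw [mul_left_comm, Complex.im_ofReal_mul, abs_mul, abs_of_pos (hγ.norm_pos u)]
  refine mul_le_mul_of_nonneg_left ?_ (norm_nonneg _)
  have := M.abs_im_conj_dir_mul_N_le (θ u) φ
  rwa [← abs_neg, ← Complex.conj_im, map_mul, Complex.conj_conj, mul_comm] at this

/-- The upper half of the isoperimetrix, as a graph. -/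
lemma exists_graph : ∃ a : ℝ, 0 < a ∧ ∃ ψ : ℝ → ℝ, Continuous ψ ∧
    (∀ x ∈ Set.Icc (-a) a, (M.N (ψ x)).re = -x) ∧
    ∫ x in (-a)..a, (M.N (ψ x)).im = M.isoperimetrixArea / 2 := by
  set E : ℝ → ℝ := fun θ => -(M.N θ).re with hE
  have hEd : ∀ θ, HasDerivAt E (M.q θ * Real.cos θ) θ := fun θ => by
    refine (Complex.reCLM.hasFDerivAt.comp_hasDerivAt θ (M.hasDerivAt_N θ)).neg.congr_deriv ?_
    simp
  have hEc : Continuous E := continuous_iff_continuousAt.2 fun θ => (hEd θ).continuousAt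
  have hpi : -(π / 2) ≤ π / 2 := by linarith [Real.pi_pos]
  have hEm : StrictMonoOn E (Set.Icc (-(π / 2)) (π / 2)) := by
    refine strictMonoOn_of_deriv_pos (convex_Icc _ _) hEc.continuousOn fun x hx => ?_
    rw [interior_Icc] at hx
    rw [(hEd x).deriv]
    exact mul_pos (M.q_pos x) (Real.cos_pos_of_mem_Ioo hx)
  set a := E (π / 2) with ha
  have ha' : E (-(π / 2)) = -a := by
    have := M.N_add_pi (-(π / 2))
    rw [show -(π / 2) + π = π / 2 by ring] at this
    simp only [ha, hE, this]
    simp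
  have ha0 : 0 < a := by
    have := hEm ⟨le_rfl, hpi⟩ ⟨hpi, le_rfl⟩ (by linarith [Real.pi_pos] : -(π / 2) < π / 2)
    linarith
  have haa : -a ≤ a := by linarith
  have hmaps : ∀ θ ∈ Set.Icc (-(π / 2)) (π / 2), E θ ∈ Set.Icc (-a) a := fun θ hθ =>
    ⟨ha' ▸ hEm.monotoneOn ⟨le_rfl, hpi⟩ hθ hθ.1, hEm.monotoneOn hθ ⟨hpi, le_rfl⟩ hθ.2⟩
  let F : Set.Icc (-(π / 2)) (π / 2) → Set.Icc (-a) a := fun θ => ⟨E θ, hmaps θ θ.2⟩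
  have hFm : StrictMono F := fun x y hxy => hEm x.2 y.2 hxy
  have hFs : Function.Surjective F := fun y => by
    obtain ⟨θ, hθ, e⟩ := intermediate_value_Icc hpi hEc.continuousOn
      (show (y : ℝ) ∈ Set.Icc (E (-(π / 2))) (E (π / 2)) by rw [ha']; exact y.2)
    exact ⟨⟨θ, hθ⟩, Subtype.ext e⟩
  let e := hFm.orderIsoOfSurjective F hFs
  -- Clamping to `[-a, a]` makes the inverse of `E` continuous on all of `ℝ`.
  let ψ : ℝ → ℝ := fun x => (e.symm (Set.projIcc (-a) a haa x) : ℝ)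
  have hψc : Continuous ψ :=
    continuous_subtype_val.comp (e.symm.continuous.comp continuous_projIcc)
  have hψE : ∀ θ ∈ Set.Icc (-(π / 2)) (π / 2), ψ (E θ) = θ := fun θ hθ => by
    simp only [ψ]
    rw [Set.projIcc_of_mem haa (hmaps θ hθ)]
    exact congrArg Subtype.val (e.symm_apply_apply ⟨θ, hθ⟩)
  have hEψ : ∀ x ∈ Set.Icc (-a) a, E (ψ x) = x := fun x hx => by
    simp only [ψ]
    rw [Set.projIcc_of_mem haa hx]
    exact congrArg Subtype.val (e.apply_symm_apply ⟨x, hx⟩)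
  refine ⟨a, ha0, ψ, hψc, fun x hx => ?_, ?_⟩
  · have := hEψ x hx
    simp only [hE] at this
    linarith
  have hNc := M.contDiff_N.continuous
  have hqc := M.contDiff_q.continuous
  have hhc := M.contDiff_h.continuous
  have hsub := intervalIntegral.integral_comp_mul_deriv (a := -(π / 2)) (b := π / 2) (f := E)
    (g := fun x => (M.N (ψ x)).im) (fun θ _ => hEd θ)
    (hqc.mul Real.continuous_cos).continuousOn (Complex.continuous_im.comp (hNc.comp hψc))
  rw [ha', ← ha] at hsub
  rw [← hsub]
  have hcongr : ∫ θ in (-(π / 2))..(π / 2),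
      ((fun x => (M.N (ψ x)).im) ∘ E) θ * (M.q θ * Real.cos θ) =
      ∫ θ in (-(π / 2))..(π / 2), (M.N θ).im * (M.q θ * Real.cos θ) := by
    apply intervalIntegral.integral_congr
    intro θ hθ
    rw [Set.uIcc_of_le hpi] at hθ
    simp only [Function.comp, hψE θ hθ]
  rw [hcongr]
  -- Compares the area under the graph with the area form. The boundary terms agree, since `N`
  -- changes sign under a half turn and the product of its coordinates does not.
  have hD : ∀ θ, HasDerivAt (fun θ => (M.N θ).re * (M.N θ).im)
      (M.h θ * M.q θ - 2 * ((M.N θ).im * (M.q θ * Real.cos θ))) θ := fun θ => by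
    have h1 := Complex.reCLM.hasFDerivAt.comp_hasDerivAt θ (M.hasDerivAt_N θ)
    have h2 := Complex.imCLM.hasFDerivAt.comp_hasDerivAt θ (M.hasDerivAt_N θ)
    refine (h1.mul h2).congr_deriv ?_
    have h3 := M.im_conj_N_mul_dir θ
    simp at h3 ⊢
    linear_combination -M.q θ * h3
  have hc1 : Continuous fun θ => M.h θ * M.q θ := hhc.mul hqc
  have hc2 : Continuous fun θ => 2 * ((M.N θ).im * (M.q θ * Real.cos θ)) := continuous_const.mul
    ((Complex.continuous_im.comp hNc).mul (hqc.mul Real.continuous_cos))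
  have hint := intervalIntegral.integral_eq_sub_of_hasDerivAt
    (a := -(π / 2)) (b := π / 2) (fun θ _ => hD θ) ((hc1.sub hc2).intervalIntegrable _ _)
  have hN2 : M.N (π / 2) = -M.N (-(π / 2)) := by
    rw [← N_add_pi]; congr 1; ring
  rw [intervalIntegral.integral_sub (hc1.intervalIntegrable _ _) (hc2.intervalIntegrable _ _),
    intervalIntegral.integral_const_mul, hN2] at hint
  have hp : Function.Periodic (fun θ => M.h θ * M.q θ) π := by
    have h1 : Function.Periodic M.h π := M.h_add_pi
    exact fun θ => by simp only [q, h1 θ, h1.deriv.deriv θ]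
  have hhalf := intervalIntegral.integral_add_adjacent_intervals (μ := volume)
    (Continuous.intervalIntegrable (hhc.mul hqc) 0 π)
    (Continuous.intervalIntegrable (hhc.mul hqc) π (2 * π))
  have h1 := hp.intervalIntegral_add_eq 0 (-(π / 2))
  have h2 := hp.intervalIntegral_add_eq π (-(π / 2))
  rw [show -(π / 2) + π = π / 2 by ring] at h1 h2
  rw [zero_add] at h1
  rw [← two_mul] at h2
  simp only [Pi.mul_apply] at hhalf
  rw [h1, h2] at hhalf
  rw [isoperimetrixArea_eq, ← hhalf]
  simp only [Complex.neg_re, Complex.neg_im] at hint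
  linarith

/-- The enclosed area as the integral of `(x - c) dy` over one period. -/
lemma _root_.AnisotropicFlow.IsClosedImmersion.enclosedArea_eq_integral {γ : ℝ → ℂ}
    (hγ : IsClosedImmersion γ) (c u₀ : ℝ) :
    enclosedArea γ = ∫ u in u₀..(u₀ + 2 * π), ((γ u).re - c) * (deriv γ u).im := by
  have hγc := hγ.smooth.continuous
  have hγ' := hγ.smooth.deriv_infty.continuous
  have hconj := Complex.continuous_conj
  have hx : ∀ u, HasDerivAt (fun u => (γ u).re) (deriv γ u).re u := fun u =>
    Complex.reCLM.hasFDerivAt.comp_hasDerivAt u (hγ.smooth.hasDerivAt_infty u)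
  have hy : ∀ u, HasDerivAt (fun u => (γ u).im) (deriv γ u).im u := fun u =>
    Complex.imCLM.hasFDerivAt.comp_hasDerivAt u (hγ.smooth.hasDerivAt_infty u)
  have hp : Function.Periodic (fun u => ((starRingEnd ℂ) (γ u) * deriv γ u).im) (2 * π) :=
    fun u => by simp only [hγ.periodic u, hγ.periodic.deriv u]
  have h1 := hp.intervalIntegral_add_eq 0 u₀
  rw [zero_add] at h1
  rw [enclosedArea_eq, h1]
  have hD : ∀ u, HasDerivAt (fun u => ((γ u).re - c) * (γ u).im - c * (γ u).im)
      (2 * (((γ u).re - c) * (deriv γ u).im) - ((starRingEnd ℂ) (γ u) * deriv γ u).im) u :=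
    fun u => by
      refine ((((hx u).sub_const c).mul (hy u)).sub ((hy u).const_mul c)).congr_deriv ?_
      simp
      ring
  have h2 := intervalIntegral.integral_eq_sub_of_hasDerivAt
    (a := u₀) (b := u₀ + 2 * π) (fun u _ => hD u) (Continuous.intervalIntegrable (by fun_prop) _ _)
  rw [hγ.periodic u₀, sub_self, intervalIntegral.integral_sub
    (Continuous.intervalIntegrable (by fun_prop) _ _)
    (Continuous.intervalIntegrable (by fun_prop) _ _), intervalIntegral.integral_const_mul] at h2
  linarith

/-- The **isoperimetric inequality** in the Minkowski plane, for closed immersed curves. -/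
theorem isoperimetric_inequality {γ : ℝ → ℂ} (hγ : IsClosedImmersion γ) :
    4 * enclosedArea γ * M.isoperimetrixArea ≤ M.length γ ^ 2 := by
  obtain ⟨a, ha, ψ, hψ, hψx, hψA⟩ := M.exists_graph
  have hγc := hγ.smooth.continuous
  have hγ' := hγ.smooth.deriv_infty.continuous
  have hNc := M.contDiff_N.continuous
  have hlc := (M.contDiff_l_deriv hγ).continuous
  have hxc : Continuous fun u => (γ u).re := Complex.continuous_re.comp hγc
  have hxd : ∀ u, HasDerivAt (fun u => (γ u).re) (deriv γ u).re u := fun u =>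
    Complex.reCLM.hasFDerivAt.comp_hasDerivAt u (hγ.smooth.hasDerivAt_infty u)
  have hxp : Function.Periodic (fun u => (γ u).re) (2 * π) := fun u => by
    simp only [hγ.periodic u]
  have hpi : (0 : ℝ) < 2 * π := by positivity
  obtain ⟨u₀, -, hmin⟩ := (isCompact_Icc (a := (0 : ℝ)) (b := 2 * π)).exists_isMinOn
    ⟨0, by simp [Real.pi_pos.le]⟩ hxc.continuousOn
  obtain ⟨u₁', -, hmax'⟩ := (isCompact_Icc (a := (0 : ℝ)) (b := 2 * π)).exists_isMaxOn
    ⟨0, by simp [Real.pi_pos.le]⟩ hxc.continuousOn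
  obtain ⟨u₁, hu₁, e₁⟩ := hxp.exists_mem_Ico hpi u₁' u₀
  have hmin' : ∀ u, (γ u₀).re ≤ (γ u).re := fun u => by
    obtain ⟨v, hv, e⟩ := hxp.exists_mem_Ico₀ hpi u
    rw [e]
    exact hmin ⟨hv.1, hv.2.le⟩
  have hmax : ∀ u, (γ u).re ≤ (γ u₁).re := fun u => by
    obtain ⟨v, hv, e⟩ := hxp.exists_mem_Ico₀ hpi u
    rw [e, ← e₁]
    exact hmax' ⟨hv.1, hv.2.le⟩
  -- If the extreme abscissae agree, the curve lies on a vertical line and has area zero.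
  rcases (hmin' u₁).eq_or_lt with heq | hlt
  · have : enclosedArea γ = 0 := by
      rw [hγ.enclosedArea_eq_integral (γ u₀).re 0]
      have : ∀ u, (γ u).re - (γ u₀).re = 0 := fun u => by linarith [hmin' u, hmax u]
      simp [this]
    rw [this]
    simp [sq_nonneg]
  -- Chosen so that the isoperimetrix scaled by `r` and shifted by `c` has the same horizontal
  -- projection as `γ`.
  set r := ((γ u₁).re - (γ u₀).re) / (2 * a) with hr
  set c := ((γ u₁).re + (γ u₀).re) / 2 with hc
  have hr0 : 0 < r := div_pos (sub_pos.2 hlt) (by positivity)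
  have hra : r * a = ((γ u₁).re - (γ u₀).re) / 2 := by rw [hr]; field_simp
  set ξ : ℝ → ℝ := fun u => ((γ u).re - c) / r with hξ
  have hrξ : ∀ u, r * ξ u = (γ u).re - c := fun u => by simp only [hξ]; field_simp
  have hξ0 : ξ u₀ = -a := by
    rw [hξ]; beta_reduce; rw [div_eq_iff hr0.ne']; linarith
  have hξ1 : ξ u₁ = a := by
    rw [hξ]; beta_reduce; rw [div_eq_iff hr0.ne']; linarith
  have hξ2 : ξ (u₀ + 2 * π) = -a := by
    rw [← hξ0, hξ]; beta_reduce; rw [hγ.periodic]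
  have hξm : ∀ u, ξ u ∈ Set.Icc (-a) a := fun u => by
    rw [hξ]; beta_reduce
    rw [Set.mem_Icc, le_div_iff₀ hr0, div_le_iff₀ hr0]
    constructor <;> linarith [hmin' u, hmax u]
  have hξd : ∀ u, HasDerivAt ξ ((deriv γ u).re / r) u := fun u =>
    ((hxd u).sub_const c).div_const r
  have hξc : Continuous ξ := continuous_iff_continuousAt.2 fun u => (hξd u).continuousAt
  set H : ℝ → ℝ := fun x => (M.N (ψ x)).im with hH
  have hHc : Continuous H := Complex.continuous_im.comp (hNc.comp hψ)
  have hre := Complex.continuous_re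
  have him := Complex.continuous_im
  -- The arc from leftmost to rightmost point is compared with the lower half, whose point at
  -- abscissa `ξ` is `-N(ψ ξ)`; the returning arc uses the upper point `N(ψ(-ξ))`. The abscissa need
  -- not be monotone along either arc.
  have hlow : ∫ u in u₀..u₁, (((γ u).re - c) * (deriv γ u).im + r * H (ξ u) * (deriv γ u).re) ≤
      ∫ u in u₀..u₁, r * M.l (deriv γ u) := by
    refine intervalIntegral.integral_mono_on hu₁.1
      (Continuous.intervalIntegrable (by fun_prop) _ _)
      (Continuous.intervalIntegrable (by fun_prop) _ _) fun u _ => ?_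
    have h1 := (abs_le.1 (M.abs_im_conj_N_mul_deriv_le hγ u (ψ (ξ u)))).1
    have h2 := hψx _ (hξm u)
    have h3 : ((γ u).re - c) * (deriv γ u).im + r * H (ξ u) * (deriv γ u).re =
        r * -((starRingEnd ℂ) (M.N (ψ (ξ u))) * deriv γ u).im := by
      simp only [Complex.mul_im, Complex.conj_re, Complex.conj_im, h2, hH]
      rw [← hrξ]
      ring
    rw [h3]
    exact mul_le_mul_of_nonneg_left (by linarith) hr0.le
  have hupp : ∫ u in u₁..(u₀ + 2 * π),
      (((γ u).re - c) * (deriv γ u).im - r * H (-ξ u) * (deriv γ u).re) ≤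
      ∫ u in u₁..(u₀ + 2 * π), r * M.l (deriv γ u) := by
    refine intervalIntegral.integral_mono_on hu₁.2.le
      (Continuous.intervalIntegrable (by fun_prop) _ _)
      (Continuous.intervalIntegrable (by fun_prop) _ _) fun u _ => ?_
    have h1 := (abs_le.1 (M.abs_im_conj_N_mul_deriv_le hγ u (ψ (-ξ u)))).2
    have h2 := hψx (-ξ u) ⟨by linarith [(hξm u).2], by linarith [(hξm u).1]⟩
    have h3 : ((γ u).re - c) * (deriv γ u).im - r * H (-ξ u) * (deriv γ u).re =
        r * ((starRingEnd ℂ) (M.N (ψ (-ξ u))) * deriv γ u).im := by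
      simp only [Complex.mul_im, Complex.conj_re, Complex.conj_im, h2, hH]
      rw [← hrξ]
      ring
    rw [h3]
    exact mul_le_mul_of_nonneg_left h1 hr0.le
  have hlowI : ∫ u in u₀..u₁, r * H (ξ u) * (deriv γ u).re =
      r ^ 2 * (M.isoperimetrixArea / 2) := by
    have := intervalIntegral.integral_comp_mul_deriv (a := u₀) (b := u₁) (f := ξ) (g := H)
      (fun u _ => hξd u) (Continuous.continuousOn (by fun_prop)) hHc
    rw [hξ0, hξ1, hψA] at this
    rw [← this, ← intervalIntegral.integral_const_mul]
    congr 1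
    funext u
    simp only [Function.comp]
    field_simp
  have huppI : ∫ u in u₁..(u₀ + 2 * π), r * H (-ξ u) * (deriv γ u).re =
      -(r ^ 2 * (M.isoperimetrixArea / 2)) := by
    have := intervalIntegral.integral_comp_mul_deriv (a := u₁) (b := u₀ + 2 * π)
      (f := fun u => -ξ u) (g := H)
      (fun u _ => (hξd u).neg) (Continuous.continuousOn (by fun_prop)) hHc
    beta_reduce at this
    rw [hξ2, hξ1, neg_neg, hψA] at this
    rw [← this, ← intervalIntegral.integral_const_mul, ← intervalIntegral.integral_neg]
    congr 1
    funext u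
    simp only [Function.comp]
    field_simp
  rw [intervalIntegral.integral_add (Continuous.intervalIntegrable (by fun_prop) _ _)
    (Continuous.intervalIntegrable (by fun_prop) _ _), hlowI] at hlow
  rw [intervalIntegral.integral_sub (Continuous.intervalIntegrable (by fun_prop) _ _)
    (Continuous.intervalIntegrable (by fun_prop) _ _), huppI] at hupp
  have hAsum := intervalIntegral.integral_add_adjacent_intervals (μ := volume)
    (f := fun u => ((γ u).re - c) * (deriv γ u).im)
    (Continuous.intervalIntegrable (by fun_prop) u₀ u₁)
    (Continuous.intervalIntegrable (by fun_prop) u₁ (u₀ + 2 * π))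
  have hLsum := intervalIntegral.integral_add_adjacent_intervals (μ := volume)
    (f := fun u => r * M.l (deriv γ u))
    (Continuous.intervalIntegrable (by fun_prop) u₀ u₁)
    (Continuous.intervalIntegrable (by fun_prop) u₁ (u₀ + 2 * π))
  rw [← hγ.enclosedArea_eq_integral] at hAsum
  rw [intervalIntegral.integral_const_mul (a := u₀) (b := u₀ + 2 * π),
    (M.l_deriv_periodic hγ).intervalIntegral_add_eq u₀ 0, zero_add] at hLsum
  have hfin : enclosedArea γ + r ^ 2 * M.isoperimetrixArea ≤ r * M.length γ := by
    rw [length]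
    linarith
  have hA := M.isoperimetrixArea_pos
  -- Completing the square in `𝒜 + r²𝒜(Ĩ) ≤ rℒ` eliminates `r`.
  nlinarith [sq_nonneg (M.length γ - 2 * r * M.isoperimetrixArea),
    mul_le_mul_of_nonneg_left hfin hA.le]

end MinkowskiPlane

/-! ### Integrals depending on a parameter -/

lemma contDiffAt_uncurry {E : Type*} [NormedAddCommGroup E] [NormedSpace ℝ E] {G : ℝ → ℝ → E}
    {U : Set ℝ} {t : ℝ} (hG : ContDiffOn ℝ ∞ (Function.uncurry G) (U ×ˢ Set.univ))
    (hU : U ∈ nhds t) (u : ℝ) : ContDiffAt ℝ ∞ (Function.uncurry G) (t, u) :=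
  hG.contDiffAt (prod_mem_nhds hU Filter.univ_mem)

lemma hasDerivAt_of_contDiffAt_fst {E : Type*} [NormedAddCommGroup E] [NormedSpace ℝ E]
    {G : ℝ → ℝ → E} {t u : ℝ} (hG : ContDiffAt ℝ ∞ (Function.uncurry G) (t, u)) :
    HasDerivAt (fun s => G s u) (fderiv ℝ (Function.uncurry G) (t, u) (1, 0)) t :=
  HasFDerivAt.comp_hasDerivAt (l := Function.uncurry G) (f := fun s => (s, u)) t
    (hG.differentiableAt (by simp)).hasFDerivAt
    ((hasDerivAt_id t).prodMk (hasDerivAt_const t u))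

lemma hasDerivAt_of_contDiffAt_snd {E : Type*} [NormedAddCommGroup E] [NormedSpace ℝ E]
    {G : ℝ → ℝ → E} {t u : ℝ} (hG : ContDiffAt ℝ ∞ (Function.uncurry G) (t, u)) :
    HasDerivAt (fun v => G t v) (fderiv ℝ (Function.uncurry G) (t, u) (0, 1)) u :=
  HasFDerivAt.comp_hasDerivAt (l := Function.uncurry G) (f := fun v => (t, v)) u
    (hG.differentiableAt (by simp)).hasFDerivAt
    ((hasDerivAt_const u t).prodMk (hasDerivAt_id u))

/-- On a compact product of a time ball and the integration range the time derivative is bounded,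
which gives a constant dominating function. -/
lemma hasDerivAt_integral_of_contDiffOn {G : ℝ → ℝ → ℝ} {G' : ℝ → ℝ} {U : Set ℝ} {t : ℝ}
    (hG : ContDiffOn ℝ ∞ (Function.uncurry G) (U ×ˢ Set.univ)) (hU : U ∈ nhds t)
    (hG' : ∀ u, HasDerivAt (fun s => G s u) (G' u) t) (a b : ℝ) :
    HasDerivAt (fun s => ∫ u in a..b, G s u) (∫ u in a..b, G' u) t := by
  obtain ⟨ε, hε, hεU⟩ := Metric.nhds_basis_closedBall.mem_iff.1 (interior_mem_nhds.2 hU)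
  have hd : ∀ s ∈ interior U, ∀ u, ContDiffAt ℝ ∞ (Function.uncurry G) (s, u) := fun s hs u =>
    contDiffAt_uncurry hG (mem_interior_iff_mem_nhds.1 hs) u
  have hGs : ∀ s ∈ interior U, Continuous (G s) := fun s hs =>
    continuous_iff_continuousAt.2 fun u => (hasDerivAt_of_contDiffAt_snd (hd s hs u)).continuousAt
  have hF : ContinuousOn (fun q : ℝ × ℝ => fderiv ℝ (Function.uncurry G) q (1, 0))
      (interior U ×ˢ Set.univ) := fun q hq =>
    (((hd q.1 hq.1 q.2).fderiv_right (m := 0) (by simp)).continuousAt.clm_apply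
      continuousAt_const).continuousWithinAt
  obtain ⟨C, hC⟩ := ((isCompact_closedBall t ε).prod
    (isCompact_uIcc (a := a) (b := b))).exists_bound_of_continuousOn
      (hF.mono (Set.prod_mono hεU (Set.subset_univ _)))
  have ht : t ∈ interior U := mem_interior_iff_mem_nhds.2 hU
  have hG'e : ∀ u, G' u = fderiv ℝ (Function.uncurry G) (t, u) (1, 0) := fun u =>
    (hG' u).unique (hasDerivAt_of_contDiffAt_fst (hd t ht u))
  have hcont : Continuous fun u => fderiv ℝ (Function.uncurry G) (t, u) (1, 0) :=
    hF.comp_continuous (by fun_prop) fun u => ⟨ht, Set.mem_univ _⟩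
  simp only [hG'e]
  refine (intervalIntegral.hasDerivAt_integral_of_dominated_loc_of_deriv_le
    (F := G) (F' := fun s u => fderiv ℝ (Function.uncurry G) (s, u) (1, 0)) (bound := fun _ => C)
    (Metric.closedBall_mem_nhds t hε) ?_ ((hGs t ht).intervalIntegrable _ _)
    hcont.aestronglyMeasurable ?_ intervalIntegrable_const ?_).2
  · filter_upwards [isOpen_interior.mem_nhds ht] with s hs
    exact (hGs s hs).aestronglyMeasurable
  · exact Filter.Eventually.of_forall fun u hu s hs => hC (s, u) ⟨hs, Set.uIoc_subset_uIcc hu⟩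
  · exact Filter.Eventually.of_forall fun u _ s hs =>
      hasDerivAt_of_contDiffAt_fst (hd s (hεU hs) u)

lemma continuousOn_integral_of_continuousOn {G : ℝ → ℝ → ℝ} {S : Set ℝ}
    (hG : ContinuousOn (Function.uncurry G) (S ×ˢ Set.univ)) (a b : ℝ) :
    ContinuousOn (fun t => ∫ u in a..b, G t u) S := by
  rw [continuousOn_iff_continuous_domRestrict]
  refine intervalIntegral.continuous_parametric_intervalIntegral_of_continuous'
    (f := fun (t : S) u => G t u) ?_ a b
  exact hG.comp_continuous (f := fun q : S × ℝ => ((q.1 : ℝ), q.2)) (by fun_prop)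
    fun q => ⟨q.1.2, Set.mem_univ _⟩

/-- Mixed partial derivatives commute. -/
lemma hasDerivAt_deriv_of_contDiffOn {E : Type*} [NormedAddCommGroup E] [NormedSpace ℝ E]
    {G : ℝ → ℝ → E} {V : ℝ → E} {U : Set ℝ} {t : ℝ}
    (hG : ContDiffOn ℝ ∞ (Function.uncurry G) (U ×ˢ Set.univ)) (hU : U ∈ nhds t)
    (hV : ∀ u, HasDerivAt (fun s => G s u) (V u) t) (u : ℝ) :
    HasDerivAt (fun s => deriv (G s) u) (deriv V u) t := by
  set f := Function.uncurry G
  have hd : ∀ s ∈ interior U, ∀ u, ContDiffAt ℝ ∞ f (s, u) := fun s hs u =>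
    contDiffAt_uncurry hG (mem_interior_iff_mem_nhds.1 hs) u
  have ht : t ∈ interior U := mem_interior_iff_mem_nhds.2 hU
  have hf2 := (((hd t ht u).fderiv_right (m := ∞) (by simp)).differentiableAt
    (by simp)).hasFDerivAt
  have hsym : IsSymmSndFDerivAt ℝ f (t, u) := (hd t ht u).isSymmSndFDerivAt (by
    rw [minSmoothness_of_isRCLikeNormedField]
    exact WithTop.coe_le_coe.2 le_top)
  have e1 : V = fun v => fderiv ℝ f (t, v) (1, 0) := funext fun v =>
    (hV v).unique (hasDerivAt_of_contDiffAt_fst (hd t ht v))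
  have h1 : HasDerivAt V (fderiv ℝ (fderiv ℝ f) (t, u) (0, 1) (1, 0)) u := by
    rw [e1]
    have := hf2.comp_hasDerivAt u ((hasDerivAt_const u t).prodMk (hasDerivAt_id u))
    exact (this.clm_apply (hasDerivAt_const u ((1 : ℝ), (0 : ℝ)))).congr_deriv (by simp)
  have h2 : HasDerivAt (fun s => fderiv ℝ f (s, u) (0, 1))
      (fderiv ℝ (fderiv ℝ f) (t, u) (1, 0) (0, 1)) t := by
    have := hf2.comp_hasDerivAt t ((hasDerivAt_id t).prodMk (hasDerivAt_const t u))
    exact (this.clm_apply (hasDerivAt_const t ((0 : ℝ), (1 : ℝ)))).congr_deriv (by simp)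
  rw [h1.deriv, hsym]
  refine h2.congr_of_eventuallyEq ?_
  filter_upwards [isOpen_interior.mem_nhds ht] with s hs
  exact (hasDerivAt_of_contDiffAt_snd (hd s hs u)).deriv

/-! ### The time interval -/

lemma zero_mem_timeInterval {T : EReal} (hT : 0 < T) : (0 : ℝ) ∈ timeInterval T :=
  ⟨le_rfl, by simpa using hT⟩

lemma ordConnected_timeInterval (T : EReal) : (timeInterval T).OrdConnected :=
  ⟨fun _ hx _ hy _ hz =>
    ⟨hx.1.trans hz.1, (EReal.coe_le_coe_iff.2 hz.2).trans_lt hy.2⟩⟩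

lemma timeInterval_mem_nhds {T : EReal} {t : ℝ} (ht : t ∈ timeInterval T) (h0 : 0 < t) :
    timeInterval T ∈ nhds t := by
  have h1 : {s : ℝ | (s : EReal) < T} ∈ nhds t :=
    (isOpen_Iio.preimage continuous_coe_real_ereal).mem_nhds ht.2
  filter_upwards [h1, lt_mem_nhds h0] with s hs hs0 using ⟨hs0.le, hs⟩

lemma exists_rat_between_timeInterval {T : EReal} {t : ℝ} (ht : t ∈ timeInterval T) :
    ∃ q : ℚ, t ≤ q ∧ (q : ℝ) ∈ timeInterval T := by
  obtain ⟨q, h1, h2⟩ := EReal.exists_rat_btwn_of_lt ht.2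
  have h1' : t < q := EReal.coe_lt_coe_iff.1 h1
  exact ⟨q, h1'.le, ht.1.trans h1'.le, h2⟩

lemma uniqueDiffOn_timeInterval {T : EReal} (hT : 0 < T) : UniqueDiffOn ℝ (timeInterval T) := by
  refine uniqueDiffOn_convex (ordConnected_timeInterval T).convex ?_
  obtain ⟨q, h1, h2⟩ := EReal.exists_rat_btwn_of_lt hT
  have h1' : (0 : ℝ) < q := EReal.coe_lt_coe_iff.1 (by simpa using h1)
  exact ⟨q, mem_interior_iff_mem_nhds.2 (timeInterval_mem_nhds ⟨h1'.le, h2⟩ h1')⟩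

/-- `S` may have an endpoint, so the joint derivative is taken within `S × ℝ`; the slices in `u` are
full lines, so in that direction it is the ordinary derivative. -/
lemma contDiffOn_deriv_snd {E : Type*} [NormedAddCommGroup E] [NormedSpace ℝ E] {S : Set ℝ}
    (hS : UniqueDiffOn ℝ S) {G : ℝ → ℝ → E}
    (hG : ContDiffOn ℝ ∞ (Function.uncurry G) (S ×ˢ Set.univ)) :
    ContDiffOn ℝ ∞ (Function.uncurry fun t u => deriv (G t) u) (S ×ˢ Set.univ) := by
  have h1 := (hG.fderivWithin (m := ∞) (hS.prod uniqueDiffOn_univ) (by simp)).clm_apply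
    (contDiffOn_const (c := ((0 : ℝ), (1 : ℝ))))
  refine h1.congr fun q hq => ?_
  have h2 := HasFDerivWithinAt.comp_hasDerivAt (l := Function.uncurry G)
    (f := fun v => (q.1, v)) q.2 (hG.differentiableOn (by simp) q hq).hasFDerivWithinAt
    ((hasDerivAt_const q.2 q.1).prodMk (hasDerivAt_id q.2))
    (Filter.Eventually.of_forall fun v => ⟨hq.1, Set.mem_univ _⟩)
  exact h2.deriv

/-- If a function decreases on `[0, T)` with speed at least `m` on `B`, then the measure of `B` is
controlled by the total decrease. -/
lemma volume_le_of_deriv_le {T : EReal} {Q Q' : ℝ → ℝ} {B : Set ℝ} {m q : ℝ} (hT : 0 < T)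
    (hQ : ContinuousOn Q (timeInterval T))
    (hQ' : ∀ t ∈ timeInterval T, 0 < t → HasDerivAt Q (Q' t) t)
    (hneg : ∀ t ∈ timeInterval T, Q' t ≤ 0) (hB : B ⊆ timeInterval T) (hm : 0 < m)
    (hBm : ∀ t ∈ B, Q' t ≤ -m) (hq : ∀ t ∈ timeInterval T, q ≤ Q t) :
    volume B ≤ ENNReal.ofReal ((Q 0 - q) / m) := by
  have key : ∀ R ∈ timeInterval T, volume (B ∩ Set.Iic R) ≤ ENNReal.ofReal ((Q 0 - q) / m) := by
    intro R hR
    have hsub : Set.Icc 0 R ⊆ timeInterval T :=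
      (ordConnected_timeInterval T).out (zero_mem_timeInterval hT) hR
    have hc : ContinuousOn (fun t => -Q t) (Set.Icc 0 R) := (hQ.mono hsub).neg
    have hd : ∀ t ∈ Set.Ioo 0 R, HasDerivAt (fun t => -Q t) (-Q' t) t := fun t ht =>
      (hQ' t (hsub ⟨ht.1.le, ht.2.le⟩) ht.1).neg
    have hi : IntegrableOn (fun t => -Q' t) (Set.Ioc 0 R) :=
      intervalIntegral.integrableOn_deriv_of_nonneg hc hd fun t ht =>
        neg_nonneg.2 (hneg t (hsub ⟨ht.1.le, ht.2.le⟩))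
    have hint := intervalIntegral.integral_eq_sub_of_hasDerivAt_of_le hR.1 hc hd
      ((intervalIntegrable_iff_integrableOn_Ioc_of_le hR.1).2 hi)
    rw [intervalIntegral.integral_of_le hR.1] at hint
    -- Chebyshev's inequality for `-Q'`, whose integral over `(0, R]` is the decrease of `Q`.
    have hmk := mul_meas_ge_le_integral_of_nonneg (μ := volume.restrict (Set.Ioc 0 R))
      (ae_restrict_of_forall_mem measurableSet_Ioc fun t ht =>
        neg_nonneg.2 (hneg t (hsub ⟨ht.1.le, ht.2⟩))) hi m
    rw [hint] at hmk
    have hle : (volume.restrict (Set.Ioc 0 R)).real {t | m ≤ -Q' t} ≤ (Q 0 - q) / m := by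
      rw [le_div_iff₀ hm]
      linarith [hq R hR]
    -- Time zero, where no two-sided derivative is supplied, is discarded as a null set. Only a
    -- superset of `B` is compared, so `B` need not be measurable.
    have hsubset : B ∩ Set.Iic R ⊆ {0} ∪ ({t | m ≤ -Q' t} ∩ Set.Ioc 0 R) := fun t ht => by
      rcases (hB ht.1).1.eq_or_lt with h | h
      · exact Or.inl h.symm
      · exact Or.inr ⟨by have := hBm t ht.1; simp only [Set.mem_ofPred_eq]; linarith, h, ht.2⟩
    calc volume (B ∩ Set.Iic R)
        ≤ volume ({0} ∪ ({t | m ≤ -Q' t} ∩ Set.Ioc 0 R)) := measure_mono hsubset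
      _ ≤ volume {(0 : ℝ)} + volume ({t | m ≤ -Q' t} ∩ Set.Ioc 0 R) := measure_union_le _ _
      _ = volume ({t | m ≤ -Q' t} ∩ Set.Ioc 0 R) := by simp
      _ ≤ (volume.restrict (Set.Ioc 0 R)) {t | m ≤ -Q' t} := Measure.le_restrict_apply _ _
      _ = ENNReal.ofReal ((volume.restrict (Set.Ioc 0 R)).real {t | m ≤ -Q' t}) :=
          (ofReal_measureReal (measure_ne_top _ _)).symm
      _ ≤ _ := ENNReal.ofReal_le_ofReal hle
  -- Rational times below `T` exhaust the interval, whether `T` is finite or not.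
  have hU : B = ⋃ q : {q : ℚ // (q : ℝ) ∈ timeInterval T}, B ∩ Set.Iic ((q : ℚ) : ℝ) := by
    ext t
    simp only [Set.mem_iUnion, Set.mem_inter_iff, Set.mem_Iic, Subtype.exists, exists_and_left,
      iff_self_and]
    intro ht
    obtain ⟨q, h1, h2⟩ := exists_rat_between_timeInterval (hB ht)
    exact ⟨q, h2, h1⟩
  rw [hU, Monotone.measure_iUnion fun a b hab =>
    Set.inter_subset_inter_right _ (Set.Iic_subset_Iic.2 (by exact_mod_cast hab))]
  exact iSup_le fun q => key _ q.2

namespace MinkowskiPlane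

variable (M : MinkowskiPlane)

/-! ### First variation formulas at a fixed time -/

section FirstVariation

variable {γ : ℝ → ℂ} (hγ : IsClosedImmersion γ) {F : ℝ → ℝ} (hF : ContDiff ℝ ∞ F)

include hγ

lemma contDiff_N_tangentAngle : ContDiff ℝ ∞ fun u => M.N (tangentAngle γ u) := by
  obtain ⟨θ, hθ⟩ := hγ.exists_isAngleLift
  rw [show (fun u => M.N (tangentAngle γ u)) = fun u => M.N (θ u) from
    funext (hθ.N_tangentAngle hγ M)]
  exact M.contDiff_N.comp hθ.smooth

lemma N_tangentAngle_periodic : Function.Periodic (fun u => M.N (tangentAngle γ u)) (2 * π) :=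
  fun u => by simp only [tangentAngle, hγ.periodic.deriv u]

lemma im_conj_N_mul_deriv (u : ℝ) :
    ((starRingEnd ℂ) (M.N (tangentAngle γ u)) * deriv γ u).im = -M.l (deriv γ u) := by
  obtain ⟨θ, hθ⟩ := hγ.exists_isAngleLift
  rw [hθ.N_tangentAngle hγ, hθ.l_deriv hγ]
  conv_lhs => rw [hθ.deriv_eq u]
  rw [mul_left_comm, Complex.im_ofReal_mul, M.im_conj_N_mul_dir]
  ring

include hF

lemma contDiff_normal_velocity :
    ContDiff ℝ ∞ fun u => (F u : ℂ) * M.N (tangentAngle γ u) :=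
  (Complex.ofRealCLM.contDiff.comp hF).mul (M.contDiff_N_tangentAngle hγ)

/-- The terms in `F_u` cancel, `-h F_u h_θ + h_θ F_u h = 0`; this is what the tangential part of `N`
is for. -/
lemma hasDerivAt_l_deriv {Γ : ℝ → ℝ → ℂ} {t : ℝ} (hΓ : Γ t = γ) (u : ℝ)
    (hd : HasDerivAt (fun s => deriv (Γ s) u)
      (deriv (fun u => (F u : ℂ) * M.N (tangentAngle γ u)) u) t) :
    HasDerivAt (fun s => M.l (deriv (Γ s) u)) (-(M.curvature γ u * F u * M.l (deriv γ u))) t := by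
  obtain ⟨θ, hθ⟩ := hγ.exists_isAngleLift
  have hV : HasDerivAt (fun u => (F u : ℂ) * M.N (tangentAngle γ u))
      (((deriv F u : ℝ) : ℂ) * M.N (θ u) +
        (F u : ℂ) * (-((deriv θ u * M.q (θ u) : ℝ) : ℂ) * dir (θ u))) u := by
    rw [show (fun u => (F u : ℂ) * M.N (tangentAngle γ u)) = fun u => (F u : ℂ) * M.N (θ u) from
      funext fun u => by rw [hθ.N_tangentAngle hγ M]]
    refine ((hF.hasDerivAt_infty u).ofReal_comp.mul
      ((M.hasDerivAt_N (θ u)).scomp u (hθ.smooth.hasDerivAt_infty u))).congr_deriv ?_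
    simp only [Function.comp, Complex.real_smul]
    push_cast
    ring
  rw [hV.deriv] at hd
  refine (M.hasDerivAt_l_comp (hγ.norm_pos u) hd (by rw [hΓ]; exact hθ.deriv_eq u)).congr_deriv ?_
  have e : (starRingEnd ℂ) (dir (θ u)) * (((deriv F u : ℝ) : ℂ) * M.N (θ u) +
        (F u : ℂ) * (-((deriv θ u * M.q (θ u) : ℝ) : ℂ) * dir (θ u))) =
      ((-(deriv F u * deriv M.h (θ u)) - F u * (deriv θ u * M.q (θ u)) : ℝ) : ℂ) +
        ((deriv F u * M.h (θ u) : ℝ) : ℂ) * Complex.I := by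
    rw [N_eq]
    have := conj_dir_mul_dir (θ u)
    push_cast
    linear_combination (((deriv F u : ℝ) : ℂ) * (-(deriv M.h (θ u) : ℝ) + (M.h (θ u) : ℝ) *
      Complex.I) - (F u : ℂ) * ((deriv θ u : ℝ) * M.q (θ u))) * this
  rw [e, mul_right_comm, hθ.curvature_mul_l hγ]
  simp only [Complex.add_re, Complex.add_im, Complex.ofReal_re, Complex.ofReal_im, Complex.mul_re,
    Complex.mul_im, Complex.I_re, Complex.I_im]
  ring

/-- Integration by parts moves the derivative from the velocity onto `γ`; each of the two terms then
contributes `-∫ F dσ`. -/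
lemma integral_area_variation (hFp : Function.Periodic F (2 * π)) :
    ∫ u in (0 : ℝ)..(2 * π), ((starRingEnd ℂ) ((F u : ℂ) * M.N (tangentAngle γ u)) * deriv γ u +
      (starRingEnd ℂ) (γ u) * deriv (fun u => (F u : ℂ) * M.N (tangentAngle γ u)) u).im =
      -2 * M.integral γ F := by
  have hV := M.contDiff_normal_velocity hγ hF
  set V : ℝ → ℂ := fun u => (F u : ℂ) * M.N (tangentAngle γ u) with hVdef
  have hVp : Function.Periodic V (2 * π) := fun u => by
    simp only [hVdef, hFp u, M.N_tangentAngle_periodic hγ u]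
  have hconj := Complex.continuous_conj
  have hVc := hV.continuous
  have hVc' := hV.deriv_infty.continuous
  have hγc := hγ.smooth.continuous
  have hγc' := hγ.smooth.deriv_infty.continuous
  have hFc := hF.continuous
  have hlc := (M.contDiff_l_deriv hγ).continuous
  have hD : ∀ u, HasDerivAt (fun u => ((starRingEnd ℂ) (γ u) * V u).im)
      (((starRingEnd ℂ) (deriv γ u) * V u + (starRingEnd ℂ) (γ u) * deriv V u).im) u := fun u =>
    Complex.imCLM.hasFDerivAt.comp_hasDerivAt u
      (((Complex.conjCLE.toContinuousLinearMap.hasFDerivAt.comp_hasDerivAt u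
        (hγ.smooth.hasDerivAt_infty u))).mul (hV.hasDerivAt_infty u))
  have hint := intervalIntegral.integral_eq_sub_of_hasDerivAt (a := 0) (b := 2 * π)
    (fun u _ => hD u) (Continuous.intervalIntegrable (by fun_prop) _ _)
  have hγ0 := hγ.periodic 0
  have hV0 := hVp 0
  rw [zero_add] at hγ0 hV0
  rw [hγ0, hV0, sub_self] at hint
  have e : ∀ u, ((starRingEnd ℂ) (V u) * deriv γ u + (starRingEnd ℂ) (γ u) * deriv V u).im =
      -2 * (F u * M.l (deriv γ u)) +
        ((starRingEnd ℂ) (deriv γ u) * V u + (starRingEnd ℂ) (γ u) * deriv V u).im := fun u => by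
    have h1 : ((starRingEnd ℂ) (V u) * deriv γ u).im = -(F u * M.l (deriv γ u)) := by
      rw [hVdef]
      beta_reduce
      rw [map_mul, Complex.conj_ofReal, mul_assoc, Complex.im_ofReal_mul,
        M.im_conj_N_mul_deriv hγ]
      ring
    have h2 : ((starRingEnd ℂ) (deriv γ u) * V u).im = -((starRingEnd ℂ) (V u) * deriv γ u).im := by
      rw [← Complex.conj_im, map_mul, Complex.conj_conj, mul_comm]
    rw [Complex.add_im, Complex.add_im, h2, h1]
    ring
  refine (intervalIntegral.integral_congr fun u _ => e u).trans ?_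
  rw [intervalIntegral.integral_add (Continuous.intervalIntegrable (by fun_prop) _ _)
    (Continuous.intervalIntegrable (by fun_prop) _ _), hint, intervalIntegral.integral_const_mul,
    add_zero]
  rfl

end FirstVariation

end MinkowskiPlane

/-! ### Evolution of length, area and total curvature. -/

namespace IsPolyharmonicFlow

variable {M : MinkowskiPlane} {p : ℕ} {T : EReal} {Γ : ℝ → ℝ → ℂ}
  (hΓ : IsPolyharmonicFlow M p T Γ)

include hΓ

lemma contDiffOn_deriv :
    ContDiffOn ℝ ∞ (Function.uncurry fun t u => deriv (Γ t) u) (timeInterval T ×ˢ Set.univ) :=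
  contDiffOn_deriv_snd (uniqueDiffOn_timeInterval hΓ.pos_time) hΓ.smooth

lemma contDiffOn_deriv_deriv :
    ContDiffOn ℝ ∞ (Function.uncurry fun t u => deriv (deriv (Γ t)) u)
      (timeInterval T ×ˢ Set.univ) :=
  contDiffOn_deriv_snd (G := fun t u => deriv (Γ t) u)
    (uniqueDiffOn_timeInterval hΓ.pos_time) hΓ.contDiffOn_deriv

lemma contDiffOn_l_deriv :
    ContDiffOn ℝ ∞ (Function.uncurry fun t u => M.l (deriv (Γ t) u))
      (timeInterval T ×ˢ Set.univ) := fun q hq =>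
  ContDiffAt.comp_contDiffWithinAt (g := M.l)
    (f := Function.uncurry fun t u => deriv (Γ t) u) q
    (M.contDiffAt_l ((hΓ.closed_immersion q.1 hq.1).immersed q.2)) (hΓ.contDiffOn_deriv q hq)

lemma contDiffOn_area :
    ContDiffOn ℝ ∞ (Function.uncurry fun t u => ((starRingEnd ℂ) (Γ t u) * deriv (Γ t) u).im)
      (timeInterval T ×ˢ Set.univ) :=
  Complex.imCLM.contDiff.comp_contDiffOn
    ((Complex.conjCLE.toContinuousLinearMap.contDiff.comp_contDiffOn hΓ.smooth).mul
      hΓ.contDiffOn_deriv)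

lemma hasDerivAt {t : ℝ} (ht : t ∈ timeInterval T) (h0 : 0 < t) (u : ℝ) :
    HasDerivAt (fun s => Γ s u)
      ((((-1) ^ p * M.curvatureDeriv (Γ t) (2 * p) u : ℝ) : ℂ) * M.N (tangentAngle (Γ t) u)) t :=
  (hΓ.evolution t ht u).hasDerivAt (timeInterval_mem_nhds ht h0)

lemma continuousOn_length : ContinuousOn (fun t => M.length (Γ t)) (timeInterval T) :=
  continuousOn_integral_of_continuousOn hΓ.contDiffOn_l_deriv.continuousOn _ _

lemma hasDerivAt_length {t : ℝ} (ht : t ∈ timeInterval T) (h0 : 0 < t) :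
    HasDerivAt (fun s => M.length (Γ s))
      (-M.integral (Γ t) (fun u => M.curvatureDeriv (Γ t) p u ^ 2)) t := by
  have hγ := hΓ.closed_immersion t ht
  have hU := timeInterval_mem_nhds ht h0
  have hF : ContDiff ℝ ∞ fun u => (-1) ^ p * M.curvatureDeriv (Γ t) (2 * p) u :=
    contDiff_const.mul (M.contDiff_curvatureDeriv hγ _)
  refine (hasDerivAt_integral_of_contDiffOn hΓ.contDiffOn_l_deriv hU
    (fun u => M.hasDerivAt_l_deriv hγ hF rfl u
      (hasDerivAt_deriv_of_contDiffOn hΓ.smooth hU (hΓ.hasDerivAt ht h0) u)) 0 (2 * π)).congr_deriv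
    ?_
  have h1 := M.integral_curvature_mul_curvatureDeriv hγ p
  have h2 : M.integral (Γ t) (fun u => M.curvatureDeriv (Γ t) p u ^ 2) =
      (-1) ^ p * M.integral (Γ t)
        (fun u => M.curvature (Γ t) u * M.curvatureDeriv (Γ t) (2 * p) u) := by
    rw [h1, ← mul_assoc, ← mul_pow]
    simp
  rw [h2, MinkowskiPlane.integral, ← intervalIntegral.integral_const_mul,
    ← intervalIntegral.integral_neg]
  congr 1
  funext u
  ring

/-- The flow preserves the enclosed area. -/
lemma enclosedArea_eq (hp : 1 ≤ p) {t : ℝ} (ht : t ∈ timeInterval T) :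
    enclosedArea (Γ t) = enclosedArea (Γ 0) := by
  have hc : ContinuousOn (fun t => enclosedArea (Γ t)) (timeInterval T) := by
    simp only [AnisotropicFlow.enclosedArea_eq]
    exact continuousOn_const.mul
      (continuousOn_integral_of_continuousOn hΓ.contDiffOn_area.continuousOn _ _)
  have hd : ∀ s ∈ timeInterval T, 0 < s → HasDerivAt (fun t => enclosedArea (Γ t)) 0 s := by
    intro s hs h0
    have hγ := hΓ.closed_immersion s hs
    have hU := timeInterval_mem_nhds hs h0
    have hF : ContDiff ℝ ∞ fun u => (-1) ^ p * M.curvatureDeriv (Γ s) (2 * p) u :=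
      contDiff_const.mul (M.contDiff_curvatureDeriv hγ _)
    have hFp : Function.Periodic (fun u => (-1) ^ p * M.curvatureDeriv (Γ s) (2 * p) u) (2 * π) :=
      fun u => congrArg ((-1) ^ p * ·) (M.curvatureDeriv_periodic hγ _ u)
    have h1 := hasDerivAt_integral_of_contDiffOn hΓ.contDiffOn_area hU (fun u =>
      Complex.imCLM.hasFDerivAt.comp_hasDerivAt s
        ((Complex.conjCLE.toContinuousLinearMap.hasFDerivAt.comp_hasDerivAt s
          (hΓ.hasDerivAt hs h0 u)).mul
          (hasDerivAt_deriv_of_contDiffOn hΓ.smooth hU (hΓ.hasDerivAt hs h0) u))) 0 (2 * π)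
    -- For `p ≥ 1` the normal speed is a `σ`-derivative, so its integral vanishes.
    have h2 : M.integral (Γ s) (fun u => (-1) ^ p * M.curvatureDeriv (Γ s) (2 * p) u) = 0 := by
      have := M.integral_curvatureDeriv hγ (m := 2 * p) (by omega)
      simp only [MinkowskiPlane.integral, mul_assoc, intervalIntegral.integral_const_mul] at this ⊢
      rw [this, mul_zero]
    have h3 := M.integral_area_variation hγ hF hFp
    rw [h2, mul_zero] at h3
    simp only [AnisotropicFlow.enclosedArea_eq]
    refine (h1.const_mul (1 / 2)).congr_deriv ?_
    refine (congrArg (1 / 2 * ·) h3).trans (by simp)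
  have hsub : Set.Icc 0 t ⊆ timeInterval T :=
    (ordConnected_timeInterval T).out (zero_mem_timeInterval hΓ.pos_time) ht
  have := intervalIntegral.integral_eq_sub_of_hasDerivAt_of_le ht.1 (hc.mono hsub)
    (fun s hs => hd s (hsub ⟨hs.1.le, hs.2.le⟩) hs.1) intervalIntegrable_const
  simp only [intervalIntegral.integral_zero] at this
  linarith

/-- The flow preserves the turning number, hence the total curvature. -/
lemma integral_curvature_eq {t : ℝ} (ht : t ∈ timeInterval T) :
    M.integral (Γ t) (M.curvature (Γ t)) = M.integral (Γ 0) (M.curvature (Γ 0)) := by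
  have h0 := zero_mem_timeInterval hΓ.pos_time
  -- The turning number as a function of time: continuous and integer-valued on an interval, hence
  -- constant.
  set f : ℝ → ℝ := fun t =>
    (∫ u in (0 : ℝ)..(2 * π), (deriv (deriv (Γ t)) u / deriv (Γ t) u).im) / (2 * π) with hf
  have hfc : ContinuousOn f (timeInterval T) :=
    (continuousOn_integral_of_continuousOn
      (G := fun t u => (deriv (deriv (Γ t)) u / deriv (Γ t) u).im)
      (Complex.continuous_im.comp_continuousOn
        (hΓ.contDiffOn_deriv_deriv.continuousOn.div hΓ.contDiffOn_deriv.continuousOn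
          fun q hq => (hΓ.closed_immersion q.1 hq.1).immersed q.2)) _ _).div_const _
  have key : ∀ s ∈ timeInterval T, ∃ n : ℤ, f s = n ∧
      M.integral (Γ s) (M.curvature (Γ s)) = n * (2 * M.isoperimetrixArea) := by
    intro s hs
    obtain ⟨n, h1, h2⟩ := M.exists_turning_number (hΓ.closed_immersion s hs)
    refine ⟨n, ?_, h2⟩
    simp only [hf]
    rw [h1]
    field_simp
  have hdisc : IsDiscrete (Set.range ((↑) : ℤ → ℝ)) :=
    ⟨Int.isClosedEmbedding_coe_real.isEmbedding.toHomeomorph.symm.isEmbedding.discreteTopology⟩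
  have hconst := (ordConnected_timeInterval T).isPreconnected.constant_of_mapsTo hdisc hfc
    (fun s hs => by obtain ⟨n, h, -⟩ := key s hs; exact ⟨n, h.symm⟩) ht h0
  obtain ⟨n, h1, h2⟩ := key t ht
  obtain ⟨m, h3, h4⟩ := key 0 h0
  rw [h2, h4, ← h1, ← h3, hconst]

end IsPolyharmonicFlow

end AnisotropicFlow

end

/-! ### The waiting-time estimate. -/

theorem mainTheorem2 (M : AnisotropicFlow.MinkowskiPlane) (p : ℕ) (hp : 1 ≤ p) :
    ∃ ε₀ : ℝ, 0 < ε₀ ∧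
      ∀ (T : EReal) (Γ : ℝ → ℝ → ℂ),
        AnisotropicFlow.IsPolyharmonicFlow M p T Γ →
        0 < AnisotropicFlow.enclosedArea (Γ 0) →
        M.kosc (Γ 0) < ε₀ →
        M.isoperimetricRatio (Γ 0) < Real.exp (ε₀ / (8 * M.isoperimetrixArea ^ 2)) →
        MeasureTheory.volume
            {t : ℝ | t ∈ AnisotropicFlow.timeInterval T ∧ ∃ u : ℝ, M.curvature (Γ t) u ≤ 0} < ⊤ ∧
          MeasureTheory.volume.real
            {t : ℝ | t ∈ AnisotropicFlow.timeInterval T ∧ ∃ u : ℝ, M.curvature (Γ t) u ≤ 0} ≤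
            8 * M.isoperimetrixArea ^ (p - 1) * AnisotropicFlow.enclosedArea (Γ 0) ^ (p + 1) /
                ((p + 1) * Real.pi ^ (2 * p)) *
              (M.isoperimetricRatio (Γ 0) ^ (p + 1) - 1) := by
  obtain ⟨m, hm, hmh⟩ := M.exists_pos_le_h
  refine ⟨m ^ 4, by positivity, fun T Γ hΓ hA hK _ => ?_⟩
  obtain ⟨k, rfl⟩ := Nat.exists_eq_add_of_le' hp
  have h0 := AnisotropicFlow.zero_mem_timeInterval hΓ.pos_time
  have hγ0 := hΓ.closed_immersion 0 h0
  have hI := M.isoperimetrixArea_pos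
  set A := AnisotropicFlow.enclosedArea (Γ 0) with hAdef
  set I := M.isoperimetrixArea with hIdef
  set L : ℝ → ℝ := fun t => M.length (Γ t) with hL
  have hLpos : ∀ t ∈ AnisotropicFlow.timeInterval T, 0 < L t := fun t ht =>
    M.length_pos (hΓ.closed_immersion t ht)
  set E : ℝ → ℝ := fun t => M.integral (Γ t) (fun u => M.curvatureDeriv (Γ t) (k + 1) u ^ 2)
    with hE
  have hE0 : ∀ t ∈ AnisotropicFlow.timeInterval T, 0 ≤ E t := fun t ht =>
    intervalIntegral.integral_nonneg (by positivity) fun u _ =>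
      mul_nonneg (sq_nonneg _) (M.l_deriv_pos (hΓ.closed_immersion t ht) u).le
  set K := M.integral (Γ 0) (M.curvature (Γ 0)) with hKdef
  -- The total curvature is an integer multiple of `2 * I`; being positive, it is at least `2 * I`.
  have hK2 : 2 * I ≤ K := by
    have hpos : 0 < K := by
      rw [hKdef, ← M.meanCurvature_mul_length hγ0]
      exact mul_pos (M.meanCurvature_pos hγ0 hm hmh hA hK) (hLpos 0 h0)
    obtain ⟨n, -, hn⟩ := M.exists_turning_number hγ0
    rw [← hKdef] at hn
    have hn1 : (1 : ℝ) ≤ n := by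
      rw [hn] at hpos
      have : (0 : ℝ) < n := (pos_iff_pos_of_mul_pos hpos).2 (by positivity)
      exact_mod_cast Int.cast_pos.1 this
    rw [hn]
    nlinarith
  set B := {t : ℝ | t ∈ AnisotropicFlow.timeInterval T ∧ ∃ u : ℝ, M.curvature (Γ t) u ≤ 0}
    with hB
  have hbad : ∀ t ∈ B, 16 * I ^ 2 * (2 * π) ^ (2 * k) ≤ L t ^ (2 * (k + 1) + 1) * E t := by
    rintro t ⟨ht, u, hu⟩
    have hγ := hΓ.closed_immersion t ht
    have hKt : M.meanCurvature (Γ t) * L t = K := by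
      rw [hL]
      beta_reduce
      rw [M.meanCurvature_mul_length hγ, hΓ.integral_curvature_eq ht]
    have hLt := hLpos t ht
    have hc : 0 < M.meanCurvature (Γ t) :=
      (pos_iff_pos_of_mul_pos (by rw [hKt]; linarith)).2 hLt
    have h1 := M.four_mul_sq_meanCurvature_le hγ hc.le hu
    have h2 := M.integral_sq_curvatureDeriv_one_le hγ k
    have h3 : 4 * M.meanCurvature (Γ t) ^ 2 ≤ L t * ((L t / (2 * π)) ^ (2 * k) * E t) :=
      h1.trans (mul_le_mul_of_nonneg_left h2 hLt.le)
    calc 16 * I ^ 2 * (2 * π) ^ (2 * k) = 4 * (2 * I) ^ 2 * (2 * π) ^ (2 * k) := by ring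
      _ ≤ 4 * K ^ 2 * (2 * π) ^ (2 * k) := by gcongr
      _ = L t ^ 2 * (4 * M.meanCurvature (Γ t) ^ 2) * (2 * π) ^ (2 * k) := by rw [← hKt]; ring
      _ ≤ L t ^ 2 * (L t * ((L t / (2 * π)) ^ (2 * k) * E t)) * (2 * π) ^ (2 * k) := by gcongr
      _ = L t ^ (2 * (k + 1) + 1) * E t := by
          rw [div_pow]
          field_simp
          ring
  have hiso : ∀ t ∈ AnisotropicFlow.timeInterval T, 4 * A * I ≤ L t ^ 2 := fun t ht => by
    rw [hAdef, ← hΓ.enclosedArea_eq hp ht]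
    exact M.isoperimetric_inequality (hΓ.closed_immersion t ht)
  -- With `p = k + 1`, the power `L ^ (2p + 2)` is the one whose derivative carries the factor `L ^
  -- (2p + 1)` of `hbad`; its lower bound is the isoperimetric inequality raised to the power `p +
  -- 1`.
  have hvol := AnisotropicFlow.volume_le_of_deriv_le (T := T) (B := B)
    (Q := fun t => L t ^ (2 * (k + 1) + 1 + 1))
    (Q' := fun t => -((2 * (k + 1) + 2) * (L t ^ (2 * (k + 1) + 1) * E t)))
    (m := (2 * (k + 1) + 2) * (16 * I ^ 2 * (2 * π) ^ (2 * k)))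
    (q := (4 * A * I) ^ (k + 2)) hΓ.pos_time (hΓ.continuousOn_length.pow _)
    (fun t ht ht0 => by
      refine ((hΓ.hasDerivAt_length ht ht0).pow (2 * (k + 1) + 1 + 1)).congr_deriv ?_
      simp only [hL, hE, Nat.add_sub_cancel]
      push_cast
      ring)
    (fun t ht => neg_nonpos.2 (mul_nonneg (by positivity)
      (mul_nonneg (pow_nonneg (hLpos t ht).le _) (hE0 t ht))))
    (fun t ht => ht.1) (by positivity)
    (fun t ht => neg_le_neg (mul_le_mul_of_nonneg_left (hbad t ht) (by positivity)))
    (fun t ht => by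
      calc (4 * A * I) ^ (k + 2) ≤ (L t ^ 2) ^ (k + 2) :=
            pow_le_pow_left₀ (by positivity) (hiso t ht) _
        _ = _ := by rw [← pow_mul]; congr 1)
  refine ⟨hvol.trans_lt ENNReal.ofReal_lt_top, ?_⟩
  set R := M.isoperimetricRatio (Γ 0) with hR
  have hRL : L 0 ^ 2 = R * (4 * A * I) := by
    rw [hR, AnisotropicFlow.MinkowskiPlane.isoperimetricRatio]
    exact (div_mul_cancel₀ _ (by positivity)).symm
  have hR1 : 1 ≤ R := by
    have := hiso 0 h0
    rw [hRL] at this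
    exact le_of_mul_le_mul_right (by linarith) (by positivity : 0 < 4 * A * I)
  have hR0 : 0 ≤ R ^ (k + 2) - 1 := sub_nonneg.2 (one_le_pow₀ hR1)
  have hQ0 : L 0 ^ (2 * (k + 1) + 1 + 1) - (4 * A * I) ^ (k + 2) =
      (4 * A * I) ^ (k + 2) * (R ^ (k + 2) - 1) := by
    rw [show 2 * (k + 1) + 1 + 1 = 2 * (k + 2) by ring, pow_mul, hRL, mul_pow]
    ring
  rw [hQ0] at hvol
  have hnn : 0 ≤ (4 * A * I) ^ (k + 2) * (R ^ (k + 2) - 1) /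
      ((2 * (k + 1) + 2) * (16 * I ^ 2 * (2 * π) ^ (2 * k))) := by positivity
  refine (ENNReal.toReal_le_of_le_ofReal hnn hvol).trans ?_
  -- The constant obtained is `π²/16` times the stated one.
  have hpi : π ^ 2 ≤ 16 := by nlinarith [Real.pi_le_four, Real.pi_pos]
  rw [mul_div_right_comm]
  refine mul_le_mul_of_nonneg_right ?_ hR0
  rw [div_le_div_iff₀ (by positivity) (by positivity), Nat.add_sub_cancel]
  push_cast
  have e1 : (4 * A * I) ^ (k + 2) * ((k + 1 + 1) * π ^ (2 * (k + 1))) =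
      16 * (A ^ (k + 2) * I ^ k * I ^ 2 * 4 ^ k * π ^ (2 * k) * (k + 2)) * π ^ 2 := by ring
  have e2 : 8 * I ^ k * A ^ (k + 1 + 1) * ((2 * (k + 1) + 2) * (16 * I ^ 2 * (2 * π) ^ (2 * k))) =
      16 * (A ^ (k + 2) * I ^ k * I ^ 2 * 4 ^ k * π ^ (2 * k) * (k + 2)) * 16 := by
    rw [show (4 : ℝ) = 2 ^ 2 by norm_num, ← pow_mul]; ring
  rw [e1, e2]
  gcongr
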